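/- Let $(t,x)\in\mathbb R\times\mathbb R^3$, $\square=\partial_t^2-\Delta$, let $\{Z\}=\{\partial_t,\ \partial_1,\partial_2,\partial_3,\ \Omega_{ij}=x_i\partial_j-x_j\partial_i\ (1\le i<j\le 3)\}$ be the space-time translation and spatial rotation fields, and let $L=t\partial_t+x\cdot\nabla_x$ be the scaling field. For a multi-index $\alpha\in\mathbb N^7$ write $Z^\alpha$ for the product $Z_1^{\alpha_1}\cdots Z_7^{\alpha_7}$ of these seven fields, taken in the order listed (the rotations as $\Omega_{12},\Omega_{13},\Omega_{23}$), and $|\alpha|=\sum_k\alpha_k$. There is an absolute constant $C$ such that the following holds for every $t\ge 0$. If $w\in C^5([0,t]\times\mathbb R^3)$ is real-valued with $\square w=F$ in $[0,t]\times\mathbb R^3$ and vanishing Cauchy data $w(0,\cdot)=\partial_tw(0,\cdot)=0$, then for every $x\in\mathbb R^3$ $$(1+t)\,|w(t,x)|\le C\int_0^t\int_{\mathbb R^3}\ \sum_{\substack{|\alpha|+j\le 3\\ j\le 1}}|L^jZ^\alpha F(s,y)|\,\frac{dy\,ds}{|y|},$$ where the right-hand side is allowed to be $+\infty$. -/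

import Mathlib

open Set MeasureTheory
open scoped NNReal ENNReal

namespace WaveEstimate

/-- Space-time `ℝ × ℝ³`; a point is `(t, x)`, and `ℝ³` carries the Euclidean norm. -/
abbrev Spacetime : Type := ℝ × EuclideanSpace ℝ (Fin 3)

/-- The time derivative `∂_t`. -/
noncomputable def dt (f : Spacetime → ℝ) : Spacetime → ℝ :=
  fun p => fderiv ℝ f p (1, 0)

/-- The spatial derivative `∂_i`. -/
noncomputable def dx (i : Fin 3) (f : Spacetime → ℝ) : Spacetime → ℝ :=
  fun p => fderiv ℝ f p (0, EuclideanSpace.single i 1)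

/-- The d'Alembertian `□ = ∂_t² - Δ`. -/
noncomputable def box (f : Spacetime → ℝ) : Spacetime → ℝ :=
  fun p => dt (dt f) p - ∑ i : Fin 3, dx i (dx i f) p

/-- The spatial rotation field `Ω_{ij} = x_i ∂_j - x_j ∂_i`. -/
noncomputable def rot (i j : Fin 3) (f : Spacetime → ℝ) : Spacetime → ℝ :=
  fun p => p.2 i * dx j f p - p.2 j * dx i f p

/-- The scaling field `L = t ∂_t + x · ∇_x`. -/
noncomputable def scaling (f : Spacetime → ℝ) : Spacetime → ℝ :=
  fun p => p.1 * dt f p + ∑ i : Fin 3, p.2 i * dx i f p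

/-- The seven fields `Z`: the space-time translations and the spatial rotations. -/
noncomputable def Z : Fin 7 → (Spacetime → ℝ) → (Spacetime → ℝ) :=
  ![dt, dx 0, dx 1, dx 2, rot 0 1, rot 0 2, rot 1 2]

/-- `Z^α = Z_0^{α_0} Z_1^{α_1} ⋯ Z_6^{α_6}` for a multi-index `α`. -/
noncomputable def Zpow (α : Fin 7 → ℕ) (f : Spacetime → ℝ) : Spacetime → ℝ :=
  (Z 0)^[α 0] ((Z 1)^[α 1] ((Z 2)^[α 2] ((Z 3)^[α 3]
    ((Z 4)^[α 4] ((Z 5)^[α 5] ((Z 6)^[α 6] f))))))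

/-- The pairs `(j, α)` with `j ≤ 1` and `|α| + j ≤ 3`. -/
def indexSet : Finset (ℕ × (Fin 7 → ℕ)) :=
  (Finset.range 2 ×ˢ Fintype.piFinset fun _ : Fin 7 => Finset.range 4).filter
    fun q => (∑ i, q.2 i) + q.1 ≤ 3

/-- The index set contains exactly the pairs it should. -/
theorem mem_indexSet (j : ℕ) (α : Fin 7 → ℕ) :
    (j, α) ∈ indexSet ↔ j ≤ 1 ∧ (∑ i, α i) + j ≤ 3 := by
  simp only [indexSet, Finset.mem_filter, Finset.mem_product, Finset.mem_range,
    Fintype.mem_piFinset]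
  constructor
  · rintro ⟨⟨h, -⟩, h'⟩
    exact ⟨by omega, h'⟩
  · rintro ⟨h, h'⟩
    refine ⟨⟨by omega, fun i => ?_⟩, h'⟩
    have := Finset.single_le_sum (f := α) (fun _ _ => Nat.zero_le _) (Finset.mem_univ i)
    omega

/-- `∑ |L^j Z^α F|` at a point, over `|α| + j ≤ 3`, `j ≤ 1`. -/
noncomputable def fieldSum (F : Spacetime → ℝ) (p : Spacetime) : ℝ :=
  ∑ q ∈ indexSet, |(scaling^[q.1] (Zpow q.2 F)) p|

end WaveEstimate

namespace WaveEstimate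

-- Write R for the weighted integral on the right. Kirchhoff's formula bounds |w(t,x)| by the
-- retarded potential ∫ |F(t-|y|, x+y)| dy/|y| (`retarded_le`). It is derived directly: along τ ↦
-- (t-τ, x+τω) the derivative of w + τ(∂_t+∂_r)w equals -τ□w up to divergences on the unit sphere.
-- Integrating over ω and τ leaves w(t,x) at τ = 0, and nothing at τ = t because the Cauchy data
-- vanish. Three bounds on the retarded potential then suffice.
--
-- Far (`norm_mul_retarded_le`): |x| times the potential is at most a multiple of R. With polar axis
-- along x and r = |y| fixed, the polar angle is traded for ρ = |x+y|; since ρ² = |x|²+r²+2|x|r cos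
-- θ, the measure |x| r sin θ dθ becomes ρ dρ. On each meridian |F| is bounded pointwise by an
-- integral of its rotation derivatives against sin ψ dψ, and ρ sin ψ dρ dφ dψ is dy/|y|.
--
-- Near (`time_mul_retarded_le`), for |x| ≤ t/2: F(p) = ∫₀¹ l²(3F+LF)(lp) dl. After z = l(x+y) the
-- kernel is 1/|z-lx|, and for fixed z the time lt-|z-lx| has slope at least t/2 in l, so t dl is at
-- most 2 ds. The kernel is bounded by the inverse distance from z to the axis ℝx, and Hardy's
-- inequality on meridians turns that weight into 1/|z| at the price of one rotation.
--
-- Small (`retarded_small_le`), for t ≤ 1 and |x| ≤ 1: a one-dimensional Sobolev bound along the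
-- rays from x, costing two translations, replaces the sphere of radius r by a ball of radius 2,
-- where 1/|x+y| is bounded below.
--
-- The quantity t|w| follows from the near bound if |x| ≤ t/2 and from the far bound otherwise. For
-- |w| itself one uses the bound on t|w| if t ≥ 1, the far bound if |x| ≥ 1, and the small bound in
-- the remaining case. At most two fields ever fall on F.

local notation "𝔼" => EuclideanSpace ℝ (Fin 3)

/-! ### Spherical coordinates in an orthonormal frame. -/

/-- The unit vector with polar angle `θ` and azimuth `φ` in the orthonormal frame `b`. -/
noncomputable def sph (b : OrthonormalBasis (Fin 3) ℝ (EuclideanSpace ℝ (Fin 3))) (θ φ : ℝ) :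
    EuclideanSpace ℝ (Fin 3) :=
  Real.cos θ • b 0 + Real.sin θ • (Real.cos φ • b 1 + Real.sin φ • b 2)

theorem lintegral_frame (b : OrthonormalBasis (Fin 3) ℝ (EuclideanSpace ℝ (Fin 3)))
    {f : EuclideanSpace ℝ (Fin 3) → ℝ≥0∞} (hf : Measurable f) :
    ∫⁻ y, f y = ∫⁻ a : ℝ, ∫⁻ q : ℝ × ℝ, f (a • b 0 + (q.1 • b 1 + q.2 • b 2)) := by
  have h1 := b.measurePreserving_repr_symm
  have h2 := PiLp.volume_preserving_toLp (Fin 3)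
  have h3 := (volume_preserving_piFinSuccAbove (fun _ : Fin 3 => ℝ) 0).symm
  have h4 := (MeasurePreserving.id (volume : Measure ℝ)).prod
    (volume_preserving_finTwoArrow ℝ).symm
  have h := ((h1.comp h2).comp h3).comp h4
  rw [← h.lintegral_comp hf]
  have e : ∀ p : ℝ × ℝ × ℝ, f (((b.repr.symm ∘ WithLp.toLp 2) ∘
      (MeasurableEquiv.piFinSuccAbove (fun _ : Fin 3 => ℝ) 0).symm)
      (Prod.map id (MeasurableEquiv.finTwoArrow (α := ℝ)).symm p)) =
      f (p.1 • b 0 + (p.2.1 • b 1 + p.2.2 • b 2)) := by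
    intro p
    congr 1
    simp [Function.comp, ← b.sum_repr_symm, Fin.sum_univ_three, add_assoc]
  simp only [Function.comp_apply] at e ⊢
  simp_rw [e]
  rw [Measure.volume_eq_prod, lintegral_prod]
  · exact (hf.comp (by fun_prop)).aemeasurable

/-- Polar coordinates are used twice: (ρ, φ) in the plane orthogonal to `b 0`, then (r, θ) in the
half-plane of pairs (a, ρ) with ρ > 0. The Jacobians ρ = r sin θ and r multiply to r² sin θ. -/
theorem lintegral_spherical (b : OrthonormalBasis (Fin 3) ℝ (EuclideanSpace ℝ (Fin 3)))
    {f : EuclideanSpace ℝ (Fin 3) → ℝ≥0∞} (hf : Measurable f) :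
    ∫⁻ y, f y = ∫⁻ r in Ioi (0 : ℝ), ∫⁻ φ in Ioo (-Real.pi) Real.pi, ∫⁻ θ in Ioo 0 Real.pi,
      ENNReal.ofReal (r ^ 2 * Real.sin θ) * f (r • sph b θ φ) := by
  rw [lintegral_frame b hf]
  have hpol (g : ℝ × ℝ → ℝ≥0∞) (hg : Measurable g) : ∫⁻ q, g q =
      ∫⁻ r in Ioi (0 : ℝ), ∫⁻ φ in Ioo (-Real.pi) Real.pi,
        ENNReal.ofReal r * g (r * Real.cos φ, r * Real.sin φ) := by
    rw [← lintegral_comp_polarCoord_symm]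
    simp only [polarCoord_target, polarCoord_symm_apply, smul_eq_mul]
    rw [Measure.volume_eq_prod, setLIntegral_prod]
    exact (Measurable.mul (by fun_prop) (hg.comp (by fun_prop))).aemeasurable
  set g : ℝ → ℝ → ℝ → ℝ≥0∞ := fun a ρ φ => ENNReal.ofReal ρ *
    f (a • b 0 + ((ρ * Real.cos φ) • b 1 + (ρ * Real.sin φ) • b 2)) with hgdef
  have hgm : Measurable (fun z : (ℝ × ℝ) × ℝ => g z.1.1 z.1.2 z.2) :=
    Measurable.mul (by fun_prop) (hf.comp (by fun_prop))
  -- Extended by zero to ρ ≤ 0, so that the polar formula on the whole plane applies; angles in (-π,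
  -- 0] then contribute nothing.
  set k : ℝ × ℝ → ℝ≥0∞ := (univ ×ˢ Ioi (0 : ℝ)).indicator
    (fun p => ∫⁻ φ in Ioo (-Real.pi) Real.pi, g p.1 p.2 φ) with hk
  have hkm' : Measurable (fun p : ℝ × ℝ => ∫⁻ φ in Ioo (-Real.pi) Real.pi, g p.1 p.2 φ) :=
    Measurable.lintegral_prod_right' (f := fun z : (ℝ × ℝ) × ℝ => g z.1.1 z.1.2 z.2) hgm
  have hkm : Measurable k := hkm'.indicator (MeasurableSet.univ.prod measurableSet_Ioi)
  calc _ = ∫⁻ a : ℝ, ∫⁻ ρ, k (a, ρ) := by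
        refine lintegral_congr fun a => ?_
        rw [hpol (fun q => f (a • b 0 + (q.1 • b 1 + q.2 • b 2))) (hf.comp (by fun_prop)), ← lintegral_indicator measurableSet_Ioi]
        refine lintegral_congr fun ρ => ?_
        by_cases h : 0 < ρ <;> simp [hk, indicator, h, hgdef]
    _ = ∫⁻ p, k p := by rw [Measure.volume_eq_prod, lintegral_prod _ hkm.aemeasurable]
    _ = _ := by
        rw [hpol k hkm]
        refine setLIntegral_congr_fun measurableSet_Ioi fun r (hr : 0 < r) => ?_
        have hsub : Ioo (0 : ℝ) Real.pi ⊆ Ioo (-Real.pi) Real.pi :=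
          Ioo_subset_Ioo_left (by linarith [Real.pi_pos])
        have e1 : ∀ ψ ∈ Ioo (-Real.pi) Real.pi,
            ENNReal.ofReal r * k (r * Real.cos ψ, r * Real.sin ψ) =
            (Ioo (0 : ℝ) Real.pi).indicator (fun ψ => ∫⁻ φ in Ioo (-Real.pi) Real.pi,
              ENNReal.ofReal (r ^ 2 * Real.sin ψ) * f (r • sph b ψ φ)) ψ := by
          intro ψ hψ
          by_cases h : 0 < ψ
          · have hs : 0 < Real.sin ψ := Real.sin_pos_of_pos_of_lt_pi h hψ.2
            have hs' : 0 < r * Real.sin ψ := mul_pos hr hs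
            rw [indicator_of_mem (show ψ ∈ Ioo (0 : ℝ) Real.pi from ⟨h, hψ.2⟩), hk,
              indicator_of_mem (by simpa using hs'),
              ← lintegral_const_mul' _ _ ENNReal.ofReal_ne_top]
            refine lintegral_congr fun φ => ?_
            simp only [hgdef]
            rw [← mul_assoc, ← ENNReal.ofReal_mul hr.le]
            congr 2
            · ring
            · simp only [sph]; module
          · have hs : Real.sin ψ ≤ 0 := Real.sin_nonpos_of_nonpos_of_neg_pi_le (not_lt.1 h) hψ.1.le
            have hs' : ¬ 0 < r * Real.sin ψ := by nlinarith
            rw [indicator_of_notMem (fun h' => h h'.1), hk, indicator_of_notMem (by simpa using hs')]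
            simp
        rw [setLIntegral_congr_fun measurableSet_Ioo e1, setLIntegral_indicator measurableSet_Ioo,
          inter_eq_left.2 hsub, lintegral_lintegral_swap]
        unfold sph
        exact (Measurable.mul (by fun_prop) (hf.comp (by fun_prop))).aemeasurable

/-! ### Hardy and Sobolev inequalities in one variable. -/

theorem ofReal_intervalIntegral {f : ℝ → ℝ} {a b : ℝ} (hab : a ≤ b) (hf : Continuous f)
    (h0 : ∀ x ∈ Ioo a b, 0 ≤ f x) :
    ENNReal.ofReal (∫ x in a..b, f x) = ∫⁻ x in Ioo a b, ENNReal.ofReal (f x) := by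
  rw [intervalIntegral.integral_of_le hab, integral_Ioc_eq_integral_Ioo,
    ofReal_integral_eq_lintegral_ofReal]
  · exact (hf.integrableOn_Icc).mono_set Ioo_subset_Icc_self
  · exact (ae_restrict_iff' measurableSet_Ioo).2 (Filter.Eventually.of_forall h0)

/-- Integration by parts against `|h|`, for a weight vanishing at both endpoints. -/
theorem integral_deriv_mul_abs_le {a a' h h' : ℝ → ℝ} {α β : ℝ} (hαβ : α ≤ β)
    (ha : ∀ x, HasDerivAt a (a' x) x) (ha' : Continuous a') (haα : a α = 0) (haβ : a β = 0)
    (hh : ∀ x, HasDerivAt h (h' x) x) (hh' : Continuous h') :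
    ∫ x in α..β, a' x * |h x| ≤ ∫ x in α..β, |a x| * |h' x| := by
  have ca : Continuous a := continuous_iff_continuousAt.2 fun x => (ha x).continuousAt
  have ch : Continuous h := continuous_iff_continuousAt.2 fun x => (hh x).continuousAt
  have key : ∀ ε : ℝ, 0 < ε → ∫ x in α..β, a' x * |h x| ≤
      (∫ x in α..β, |a x| * |h' x|) + ε * ∫ x in α..β, |a' x| := by
    intro ε hε
    -- A smooth substitute for |h|, within ε of it and with derivative at most |h'| in absolute
    -- value.
    set k : ℝ → ℝ := fun x => Real.sqrt (h x ^ 2 + ε ^ 2) with hk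
    have hpos : ∀ x, 0 < h x ^ 2 + ε ^ 2 := fun x => by positivity
    have hkpos : ∀ x, 0 < k x := fun x => Real.sqrt_pos.2 (hpos x)
    have hkd : ∀ x, HasDerivAt k (h x * h' x / k x) x := by
      intro x
      have h1 := (((hh x).pow 2).add_const (ε ^ 2)).sqrt (hpos x).ne'
      refine HasDerivAt.congr_deriv (f := k) h1 ?_
      have := hkpos x
      change ((2 : ℕ) : ℝ) * h x ^ (2 - 1) * h' x / (2 * k x) = _
      field_simp
      norm_num
      ring
    have ck : Continuous k := by fun_prop
    have ck' : Continuous fun x => h x * h' x / k x :=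
      (ch.mul hh').div ck fun x => (hkpos x).ne'
    have hhk : ∀ x, |h x| ≤ k x := fun x => Real.abs_le_sqrt (by nlinarith [sq_nonneg ε])
    have hkh : ∀ x, k x ≤ |h x| + ε := fun x => Real.sqrt_le_iff.2
      ⟨by positivity, by nlinarith [sq_abs (h x), abs_nonneg (h x)]⟩
    have hparts := intervalIntegral.integral_mul_deriv_eq_deriv_mul (a := α) (b := β)
      (u := a) (v := k) (u' := a') (v' := fun x => h x * h' x / k x)
      (fun x _ => ha x) (fun x _ => hkd x)
      (ha'.intervalIntegrable _ _) (ck'.intervalIntegrable _ _)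
    rw [haα, haβ] at hparts
    have e1 : ∫ x in α..β, a' x * k x = ∫ x in α..β, -(a x * (h x * h' x / k x)) := by
      rw [intervalIntegral.integral_neg]; linarith
    have e2 : ∫ x in α..β, -(a x * (h x * h' x / k x)) ≤ ∫ x in α..β, |a x| * |h' x| := by
      refine intervalIntegral.integral_mono_on hαβ ((ca.mul ck').neg.intervalIntegrable _ _)
        ((ca.abs.mul hh'.abs).intervalIntegrable _ _) fun x _ => ?_
      refine (neg_le_abs _).trans ?_
      rw [abs_mul, abs_div, abs_mul, abs_of_pos (hkpos x)]
      gcongr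
      rw [div_le_iff₀ (hkpos x), mul_comm]
      gcongr
      exact hhk x
    have e3 : ∫ x in α..β, a' x * |h x| ≤ ∫ x in α..β, (a' x * k x + ε * |a' x|) := by
      refine intervalIntegral.integral_mono_on hαβ ((ha'.mul ch.abs).intervalIntegrable _ _)
        (((ha'.mul ck).add (continuous_const.mul ha'.abs)).intervalIntegrable _ _) fun x _ => ?_
      have : a' x * (|h x| - k x) ≤ |a' x| * ε := by
        refine (le_abs_self _).trans ?_
        rw [abs_mul]
        gcongr
        rw [abs_le]
        constructor <;> linarith [hhk x, hkh x]
      linarith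
    rw [intervalIntegral.integral_add (Continuous.intervalIntegrable (by fun_prop) _ _)
      (Continuous.intervalIntegrable (by fun_prop) _ _),
      intervalIntegral.integral_const_mul] at e3
    linarith
  have hM : 0 ≤ ∫ x in α..β, |a' x| :=
    intervalIntegral.integral_nonneg hαβ fun x _ => abs_nonneg _
  refine le_of_forall_pos_le_add fun δ hδ => ?_
  refine (key (δ / (1 + ∫ x in α..β, |a' x|)) (by positivity)).trans ?_
  gcongr
  rw [div_mul_eq_mul_div, div_le_iff₀ (by positivity)]
  nlinarith

/-- Hardy's inequality on a meridian of the sphere. -/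
theorem integral_abs_le_integral_sin {h h' : ℝ → ℝ} (hh : ∀ x, HasDerivAt h (h' x) x)
    (hh' : Continuous h') :
    ∫ x in (0 : ℝ)..Real.pi, |h x| ≤
      ∫ x in (0 : ℝ)..Real.pi, 2 * ((|h x| + |h' x|) * Real.sin x) := by
  have ch : Continuous h := continuous_iff_continuousAt.2 fun x => (hh x).continuousAt
  -- The weight sin·cos has derivative 1 - 2 sin², so the unweighted |h| is recovered up to terms
  -- that carry a factor sin.
  have h1 := integral_deriv_mul_abs_le (a := fun x => Real.sin x * Real.cos x)
    (a' := fun x => Real.cos x * Real.cos x + Real.sin x * (-Real.sin x)) Real.pi_pos.le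
    (fun x => (Real.hasDerivAt_sin x).mul (Real.hasDerivAt_cos x)) (by fun_prop)
    (by simp) (by simp) hh hh'
  have h2 : ∫ x in (0 : ℝ)..Real.pi, (|h x| + |Real.sin x * Real.cos x| * |h' x|) ≤
      ∫ x in (0 : ℝ)..Real.pi, (2 * ((|h x| + |h' x|) * Real.sin x) +
        (Real.cos x * Real.cos x + Real.sin x * (-Real.sin x)) * |h x|) := by
    refine intervalIntegral.integral_mono_on Real.pi_pos.le
      (Continuous.intervalIntegrable (by fun_prop) _ _)
      (Continuous.intervalIntegrable (by fun_prop) _ _) fun x hx => ?_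
    have hs : 0 ≤ Real.sin x := Real.sin_nonneg_of_nonneg_of_le_pi hx.1 hx.2
    have hs1 := Real.sin_le_one x
    have hsc := Real.sin_sq_add_cos_sq x
    rw [abs_mul, abs_of_nonneg hs]
    have e1 : Real.sin x * |Real.cos x| * |h' x| ≤ Real.sin x * 1 * |h' x| := by
      gcongr; exact Real.abs_cos_le_one x
    have e2 : 0 ≤ |h x| * (Real.sin x * (1 - Real.sin x)) :=
      mul_nonneg (abs_nonneg _) (mul_nonneg hs (by linarith))
    have e3 : 0 ≤ Real.sin x * |h' x| := by positivity
    have e4 : Real.cos x * Real.cos x = 1 - Real.sin x ^ 2 := by linarith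
    rw [e4]
    nlinarith
  rw [intervalIntegral.integral_add (Continuous.intervalIntegrable (by fun_prop) _ _)
    (Continuous.intervalIntegrable (by fun_prop) _ _),
    intervalIntegral.integral_add (Continuous.intervalIntegrable (by fun_prop) _ _)
    (Continuous.intervalIntegrable (by fun_prop) _ _)] at h2
  linarith

theorem lintegral_abs_le_lintegral_sin {h h' : ℝ → ℝ} (hh : ∀ x, HasDerivAt h (h' x) x)
    (hh' : Continuous h') :
    ∫⁻ x in Ioo 0 Real.pi, ENNReal.ofReal |h x| ≤
      ∫⁻ x in Ioo 0 Real.pi, ENNReal.ofReal (2 * ((|h x| + |h' x|) * Real.sin x)) := by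
  have ch : Continuous h := continuous_iff_continuousAt.2 fun x => (hh x).continuousAt
  rw [← ofReal_intervalIntegral Real.pi_pos.le (by fun_prop) fun x _ => abs_nonneg _,
    ← ofReal_intervalIntegral Real.pi_pos.le (by fun_prop) fun x hx => ?_]
  · exact ENNReal.ofReal_le_ofReal (integral_abs_le_integral_sin hh hh')
  · have := Real.sin_nonneg_of_nonneg_of_le_pi hx.1.le hx.2.le
    positivity

/-- Sobolev's inequality on an interval. -/
theorem abs_mul_sub_le_integral {h h' : ℝ → ℝ} (hh : ∀ x, HasDerivAt h (h' x) x)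
    (hh' : Continuous h') {β θ : ℝ} (h0 : 0 ≤ θ) (hβ : θ ≤ β) :
    β * |h θ| ≤ ∫ x in (0 : ℝ)..β, (|h x| + β * |h' x|) := by
  have ch : Continuous h := continuous_iff_continuousAt.2 fun x => (hh x).continuousAt
  have i : ∀ u v, IntervalIntegrable (fun x => |h x| + β * |h' x|) volume u v := fun u v =>
    Continuous.intervalIntegrable (by fun_prop) _ _
  -- The primitives x·h on [0,θ] and (x-β)·h on [θ,β] vanish at the outer endpoints; their
  -- increments add up to β·h θ.
  have e1 : ∫ x in (0 : ℝ)..θ, (1 * h x + x * h' x) = θ * h θ - 0 * h 0 :=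
    intervalIntegral.integral_eq_sub_of_hasDerivAt
      (fun x _ => (hasDerivAt_id x).mul (hh x)) (Continuous.intervalIntegrable (by fun_prop) _ _)
  have e2 : ∫ x in θ..β, (1 * h x + (x - β) * h' x) = (β - β) * h β - (θ - β) * h θ :=
    intervalIntegral.integral_eq_sub_of_hasDerivAt
      (fun x _ => ((hasDerivAt_id x).sub_const β).mul (hh x))
      (Continuous.intervalIntegrable (by fun_prop) _ _)
  have b1 : |∫ x in (0 : ℝ)..θ, (1 * h x + x * h' x)| ≤
      ∫ x in (0 : ℝ)..θ, (|h x| + β * |h' x|) := by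
    rw [← Real.norm_eq_abs]
    refine intervalIntegral.norm_integral_le_of_norm_le h0
      (Filter.Eventually.of_forall fun x hx => ?_) (i _ _)
    refine (norm_add_le _ _).trans ?_
    rw [one_mul, norm_mul, Real.norm_eq_abs, Real.norm_eq_abs, Real.norm_eq_abs,
      abs_of_pos hx.1]
    gcongr
    exact hx.2.trans hβ
  have b2 : |∫ x in θ..β, (1 * h x + (x - β) * h' x)| ≤
      ∫ x in θ..β, (|h x| + β * |h' x|) := by
    rw [← Real.norm_eq_abs]
    refine intervalIntegral.norm_integral_le_of_norm_le hβ
      (Filter.Eventually.of_forall fun x hx => ?_) (i _ _)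
    refine (norm_add_le _ _).trans ?_
    rw [one_mul, norm_mul, Real.norm_eq_abs, Real.norm_eq_abs, Real.norm_eq_abs]
    gcongr
    rw [abs_le]
    constructor <;> linarith [hx.1, hx.2]
  rw [← intervalIntegral.integral_add_adjacent_intervals (i 0 θ) (i θ β)]
  have : β * |h θ| = |β * h θ| := by rw [abs_mul, abs_of_nonneg (h0.trans hβ)]
  rw [this]
  have : β * h θ = (∫ x in (0 : ℝ)..θ, (1 * h x + x * h' x)) +
      ∫ x in θ..β, (1 * h x + (x - β) * h' x) := by rw [e1, e2]; ring
  rw [this]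
  exact (abs_add_le _ _).trans (add_le_add b1 b2)

/-- Pointwise bound on a meridian by the spherical measure, at the cost of two derivatives. -/
theorem abs_le_lintegral_sin {h h' h'' : ℝ → ℝ} (hh : ∀ x, HasDerivAt h (h' x) x)
    (hh' : ∀ x, HasDerivAt h' (h'' x) x) (hh'' : Continuous h'') {θ : ℝ}
    (hθ : θ ∈ Ioo 0 Real.pi) :
    ENNReal.ofReal |h θ| ≤ ∫⁻ x in Ioo 0 Real.pi,
      ENNReal.ofReal (4 * ((|h x| + |h' x| + |h'' x|) * Real.sin x)) := by
  have ch : Continuous h := continuous_iff_continuousAt.2 fun x => (hh x).continuousAt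
  have ch' : Continuous h' := continuous_iff_continuousAt.2 fun x => (hh' x).continuousAt
  have h1 := abs_mul_sub_le_integral hh ch' hθ.1.le hθ.2.le
  have h2 := integral_abs_le_integral_sin hh ch'
  have h3 := integral_abs_le_integral_sin hh' hh''
  rw [intervalIntegral.integral_add (Continuous.intervalIntegrable (by fun_prop) _ _)
    (Continuous.intervalIntegrable (by fun_prop) _ _),
    intervalIntegral.integral_const_mul] at h1
  rw [← ofReal_intervalIntegral Real.pi_pos.le (by fun_prop) fun x hx => ?_]
  · refine ENNReal.ofReal_le_ofReal ?_
    -- After division by π the Sobolev bound reads ∫|h| + ∫|h'|, and Hardy's inequality inserts the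
    -- missing sin in each term.
    have h4 : (∫ x in (0 : ℝ)..Real.pi, 2 * ((|h x| + |h' x|) * Real.sin x)) +
        (∫ x in (0 : ℝ)..Real.pi, 2 * ((|h' x| + |h'' x|) * Real.sin x)) ≤
        ∫ x in (0 : ℝ)..Real.pi, 4 * ((|h x| + |h' x| + |h'' x|) * Real.sin x) := by
      rw [← intervalIntegral.integral_add (Continuous.intervalIntegrable (by fun_prop) _ _)
        (Continuous.intervalIntegrable (by fun_prop) _ _)]
      refine intervalIntegral.integral_mono_on Real.pi_pos.le
        (Continuous.intervalIntegrable (by fun_prop) _ _)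
        (Continuous.intervalIntegrable (by fun_prop) _ _) fun x hx => ?_
      have hs : 0 ≤ Real.sin x := Real.sin_nonneg_of_nonneg_of_le_pi hx.1 hx.2
      nlinarith [mul_nonneg hs (abs_nonneg (h x)), mul_nonneg hs (abs_nonneg (h' x)),
        mul_nonneg hs (abs_nonneg (h'' x))]
    have h5 : 0 ≤ ∫ x in (0 : ℝ)..Real.pi, |h x| :=
      intervalIntegral.integral_nonneg Real.pi_pos.le fun x _ => abs_nonneg _
    have hpi : (1 : ℝ) ≤ Real.pi := by linarith [Real.pi_gt_three]
    have : Real.pi * |h θ| ≤ Real.pi * ((∫ x in (0 : ℝ)..Real.pi, |h x|) +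
        ∫ x in (0 : ℝ)..Real.pi, |h' x|) := by nlinarith
    have := le_of_mul_le_mul_left this Real.pi_pos
    linarith
  · have := Real.sin_nonneg_of_nonneg_of_le_pi hx.1.le hx.2.le
    positivity

/-- The weight x²(2-x) vanishes at both ends and has derivative 4x - 3x². Integrating it by parts
against |h| raises the weight x to x² at the price of one derivative. -/
theorem four_integral_id_mul_abs_le {h h' : ℝ → ℝ} (hh : ∀ x, HasDerivAt h (h' x) x)
    (hh' : Continuous h') :
    4 * ∫ x in (0 : ℝ)..2, x * |h x| ≤ 3 * ∫ x in (0 : ℝ)..2, x ^ 2 * (|h x| + |h' x|) := by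
  have ch : Continuous h := continuous_iff_continuousAt.2 fun x => (hh x).continuousAt
  have h1 := integral_deriv_mul_abs_le (a := fun x => x ^ 2 * (2 - x))
    (a' := fun x => ((2 : ℕ) * x ^ (2 - 1)) * (2 - x) + x ^ 2 * (-1)) zero_le_two
    (fun x => (hasDerivAt_pow 2 x).mul ((hasDerivAt_id x).const_sub 2)) (by fun_prop)
    (by simp) (by simp) hh hh'
  have h2 : ∫ x in (0 : ℝ)..2, (4 * (x * |h x|) + |x ^ 2 * (2 - x)| * |h' x|) ≤
      ∫ x in (0 : ℝ)..2, (3 * (x ^ 2 * (|h x| + |h' x|)) +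
        (((2 : ℕ) * x ^ (2 - 1)) * (2 - x) + x ^ 2 * (-1)) * |h x|) := by
    refine intervalIntegral.integral_mono_on zero_le_two
      (Continuous.intervalIntegrable (by fun_prop) _ _)
      (Continuous.intervalIntegrable (by fun_prop) _ _) fun x hx => ?_
    rw [abs_of_nonneg (mul_nonneg (sq_nonneg x) (by linarith [hx.2]))]
    have e1 : 0 ≤ x ^ 2 * |h' x| := by positivity
    have e2 : 0 ≤ x * (x ^ 2 * |h' x|) := mul_nonneg hx.1 e1
    norm_num
    nlinarith
  rw [intervalIntegral.integral_add (Continuous.intervalIntegrable (by fun_prop) _ _)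
    (Continuous.intervalIntegrable (by fun_prop) _ _),
    intervalIntegral.integral_add (Continuous.intervalIntegrable (by fun_prop) _ _)
    (Continuous.intervalIntegrable (by fun_prop) _ _), intervalIntegral.integral_const_mul,
    intervalIntegral.integral_const_mul] at h2
  linarith

/-- Weighted pointwise bound along a ray by the radial measure `r² dr`. -/
theorem mul_abs_le_lintegral_sq {g g' g'' : ℝ → ℝ} (hg : ∀ x, HasDerivAt g (g' x) x)
    (hg' : ∀ x, HasDerivAt g' (g'' x) x) (hg'' : Continuous g'') {τ : ℝ}
    (h0 : 0 ≤ τ) (h1 : τ ≤ 1) :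
    ENNReal.ofReal (τ * |g τ|) ≤ ∫⁻ x in Ioo 0 2,
      ENNReal.ofReal (5 * (x ^ 2 * (|g x| + |g' x| + |g'' x|))) := by
  have cg : Continuous g := continuous_iff_continuousAt.2 fun x => (hg x).continuousAt
  have cg' : Continuous g' := continuous_iff_continuousAt.2 fun x => (hg' x).continuousAt
  rw [← ofReal_intervalIntegral zero_le_two (by fun_prop) fun x hx => by positivity]
  refine ENNReal.ofReal_le_ofReal ?_
  -- The factor 2-x is at least 1 at τ ≤ 1, so it costs nothing there; the vanishing at 2 is used in
  -- `b3`.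
  have e1 : ∫ x in (0 : ℝ)..τ, ((1 * (2 - x) + x * (-1)) * g x + x * (2 - x) * g' x) =
      τ * (2 - τ) * g τ - 0 * (2 - 0) * g 0 :=
    intervalIntegral.integral_eq_sub_of_hasDerivAt
      (fun x _ => ((hasDerivAt_id x).mul ((hasDerivAt_id x).const_sub 2)).mul (hg x))
      (Continuous.intervalIntegrable (by fun_prop) _ _)
  have b1 : |∫ x in (0 : ℝ)..τ, ((1 * (2 - x) + x * (-1)) * g x + x * (2 - x) * g' x)| ≤
      ∫ x in (0 : ℝ)..τ, (2 * |g x| + 2 * (x * |g' x|)) := by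
    rw [← Real.norm_eq_abs]
    refine intervalIntegral.norm_integral_le_of_norm_le h0
      (Filter.Eventually.of_forall fun x hx => ?_)
      (Continuous.intervalIntegrable (by fun_prop) _ _)
    refine (norm_add_le _ _).trans ?_
    rw [norm_mul, norm_mul, Real.norm_eq_abs, Real.norm_eq_abs, Real.norm_eq_abs,
      Real.norm_eq_abs, ← mul_assoc 2]
    gcongr
    · rw [abs_le]; constructor <;> linarith [hx.1, hx.2]
    · rw [abs_le]; constructor <;> nlinarith [hx.1, hx.2]
  have b2 : ∫ x in (0 : ℝ)..τ, (2 * |g x| + 2 * (x * |g' x|)) ≤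
      ∫ x in (0 : ℝ)..2, (2 * |g x| + 2 * (x * |g' x|)) := by
    refine intervalIntegral.integral_mono_interval le_rfl h0 (by linarith) ?_
      (Continuous.intervalIntegrable (by fun_prop) _ _)
    refine (ae_restrict_iff' measurableSet_Ioc).2 (Filter.Eventually.of_forall fun x hx => ?_)
    have := hx.1.le
    show (0 : ℝ) ≤ _
    positivity
  -- Since (x(2-x))' = 2-2x, this replaces 2∫|g| by 2∫x|g| + 2∫x|g'|, raising the weight from 1 to
  -- x.
  have b3 := integral_deriv_mul_abs_le (a := fun x => x * (2 - x))
    (a' := fun x => 1 * (2 - x) + x * (-1)) zero_le_two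
    (fun x => (hasDerivAt_id x).mul ((hasDerivAt_id x).const_sub 2)) (by fun_prop)
    (by simp) (by simp) hg cg'
  have b4 : ∫ x in (0 : ℝ)..2, (2 * |g x| + |x * (2 - x)| * |g' x|) ≤
      ∫ x in (0 : ℝ)..2, ((2 * (x * |g x|) + 2 * (x * |g' x|)) +
        (1 * (2 - x) + x * (-1)) * |g x|) := by
    refine intervalIntegral.integral_mono_on zero_le_two
      (Continuous.intervalIntegrable (by fun_prop) _ _)
      (Continuous.intervalIntegrable (by fun_prop) _ _) fun x hx => ?_
    rw [abs_of_nonneg (mul_nonneg hx.1 (by linarith [hx.2]))]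
    have e2 : 0 ≤ x * (x * |g' x|) := mul_nonneg hx.1 (mul_nonneg hx.1 (abs_nonneg _))
    nlinarith
  have i1 : IntervalIntegrable (fun x => |g x|) volume 0 2 :=
    Continuous.intervalIntegrable (by fun_prop) _ _
  have i2 : IntervalIntegrable (fun x => x * |g x|) volume 0 2 :=
    Continuous.intervalIntegrable (by fun_prop) _ _
  have i3 : IntervalIntegrable (fun x => x * |g' x|) volume 0 2 :=
    Continuous.intervalIntegrable (by fun_prop) _ _
  rw [intervalIntegral.integral_add (i1.const_mul 2)
    (Continuous.intervalIntegrable (by fun_prop) _ _),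
    intervalIntegral.integral_add ((i2.const_mul 2).add (i3.const_mul 2))
    (Continuous.intervalIntegrable (by fun_prop) _ _),
    intervalIntegral.integral_add (i2.const_mul 2) (i3.const_mul 2)] at b4
  rw [intervalIntegral.integral_add (f := fun x => 2 * |g x|) (i1.const_mul 2)
    (i3.const_mul 2)] at b2
  simp only [intervalIntegral.integral_const_mul] at b2 b4
  have b5 := four_integral_id_mul_abs_le hg cg'
  have b6 := four_integral_id_mul_abs_le hg' hg''
  -- What is left is 2∫x|g| + 4∫x|g'|, and `b5`, `b6` give the coefficients 3/2 and 3. The largest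
  -- total coefficient is 9/2, on |g'|.
  have b7 : (3 / 2) * (∫ x in (0 : ℝ)..2, x ^ 2 * (|g x| + |g' x|)) +
      3 * (∫ x in (0 : ℝ)..2, x ^ 2 * (|g' x| + |g'' x|)) ≤
      ∫ x in (0 : ℝ)..2, 5 * (x ^ 2 * (|g x| + |g' x| + |g'' x|)) := by
    rw [← intervalIntegral.integral_const_mul, ← intervalIntegral.integral_const_mul,
      ← intervalIntegral.integral_add (Continuous.intervalIntegrable (by fun_prop) _ _)
      (Continuous.intervalIntegrable (by fun_prop) _ _)]
    refine intervalIntegral.integral_mono_on zero_le_two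
      (Continuous.intervalIntegrable (by fun_prop) _ _)
      (Continuous.intervalIntegrable (by fun_prop) _ _) fun x hx => ?_
    nlinarith [mul_nonneg (sq_nonneg x) (abs_nonneg (g x)),
      mul_nonneg (sq_nonneg x) (abs_nonneg (g' x)), mul_nonneg (sq_nonneg x) (abs_nonneg (g'' x))]
  have e2 : τ * |g τ| ≤ |τ * (2 - τ) * g τ - 0 * (2 - 0) * g 0| := by
    rw [zero_mul, zero_mul, sub_zero, abs_mul, abs_of_nonneg (mul_nonneg h0 (by linarith))]
    gcongr
    nlinarith
  rw [← e1] at e2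
  linarith

/-- The increment of a function is at most the integral of its derivative, on an interval
with possibly singular endpoints. -/
theorem ofReal_abs_sub_le_lintegral {k k' : ℝ → ℝ} {a b : ℝ} (hab : a ≤ b)
    (hk : ContinuousOn k (Icc a b)) (hd : ∀ x ∈ Ioo a b, HasDerivAt k (k' x) x)
    (hk' : ContinuousOn k' (Ioo a b)) :
    ENNReal.ofReal |k b - k a| ≤ ∫⁻ x in Ioo a b, ENNReal.ofReal |k' x| := by
  by_cases hfin : ∫⁻ x in Ioo a b, ENNReal.ofReal |k' x| = ∞
  · rw [hfin]; exact le_top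
  have hm : AEStronglyMeasurable k' (volume.restrict (Ioo a b)) :=
    hk'.aestronglyMeasurable measurableSet_Ioo
  have hint : IntegrableOn k' (Ioo a b) := by
    refine ⟨hm, ?_⟩
    rw [hasFiniteIntegral_iff_norm]
    exact lt_top_iff_ne_top.2 hfin
  have hii : IntervalIntegrable k' volume a b :=
    (intervalIntegrable_iff_integrableOn_Ioo_of_le hab).2 hint
  rw [← intervalIntegral.integral_eq_sub_of_hasDerivAt_of_le hab hk hd hii,
    intervalIntegral.integral_of_le hab, integral_Ioc_eq_integral_Ioo]
  have := enorm_integral_le_lintegral_enorm (μ := volume.restrict (Ioo a b)) k'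
  simpa [Real.enorm_eq_ofReal_abs] using this

/-! ### Slabs, and solutions with derivatives continuous up to the boundary. -/

/-- The open slab `(0, t) × ℝ³`. -/
def openSlab (t : ℝ) : Set Spacetime := Ioo 0 t ×ˢ univ

/-- The closed slab `[0, t] × ℝ³`. -/
def closedSlab (t : ℝ) : Set Spacetime := Icc 0 t ×ˢ univ

theorem mem_openSlab {t : ℝ} {p : Spacetime} : p ∈ openSlab t ↔ 0 < p.1 ∧ p.1 < t := by
  simp [openSlab]

theorem mem_closedSlab {t : ℝ} {p : Spacetime} : p ∈ closedSlab t ↔ 0 ≤ p.1 ∧ p.1 ≤ t := by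
  simp [closedSlab]

theorem isOpen_openSlab (t : ℝ) : IsOpen (openSlab t) := isOpen_Ioo.prod isOpen_univ

theorem openSlab_subset (t : ℝ) : openSlab t ⊆ closedSlab t :=
  prod_mono Ioo_subset_Icc_self subset_rfl

theorem uniqueDiffOn_closedSlab {t : ℝ} (ht : 0 < t) : UniqueDiffOn ℝ (closedSlab t) :=
  (uniqueDiffOn_Icc ht).prod uniqueDiffOn_univ

theorem closedSlab_mem_nhds {t : ℝ} {p : Spacetime} (hp : p ∈ openSlab t) :
    closedSlab t ∈ nhds p :=
  Filter.mem_of_superset ((isOpen_openSlab t).mem_nhds hp) (openSlab_subset t)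

/-- First and second derivatives of a function on the slab, continuous up to the boundary. -/
structure SlabJet (t : ℝ) (w : Spacetime → ℝ) where
  /-- the first derivative -/
  d1 : Spacetime → Spacetime →L[ℝ] ℝ
  /-- the second derivative -/
  d2 : Spacetime → Spacetime →L[ℝ] Spacetime →L[ℝ] ℝ
  continuousOn : ContinuousOn w (closedSlab t)
  continuousOn_d1 : ContinuousOn d1 (closedSlab t)
  continuousOn_d2 : ContinuousOn d2 (closedSlab t)
  hasFDerivWithinAt : ∀ p ∈ closedSlab t, HasFDerivWithinAt w (d1 p) (closedSlab t) p
  hasFDerivAt_d1 : ∀ p ∈ openSlab t, HasFDerivAt d1 (d2 p) p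

namespace SlabJet

variable {t : ℝ} {w : Spacetime → ℝ}

theorem nonempty (ht : 0 < t) (hw : ContDiffOn ℝ 2 w (closedSlab t)) :
    Nonempty (SlabJet t w) := by
  have h1 : ContDiffOn ℝ 1 (fderivWithin ℝ w (closedSlab t)) (closedSlab t) :=
    hw.fderivWithin (uniqueDiffOn_closedSlab ht) (by norm_num)
  refine ⟨⟨_, fderivWithin ℝ (fderivWithin ℝ w (closedSlab t)) (closedSlab t), hw.continuousOn,
    h1.continuousOn, h1.continuousOn_fderivWithin (uniqueDiffOn_closedSlab ht) le_rfl,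
    fun p hp => (hw.differentiableOn (by norm_num) p hp).hasFDerivWithinAt, fun p hp => ?_⟩⟩
  exact (h1.differentiableOn (by norm_num) p
    (openSlab_subset t hp)).hasFDerivWithinAt.hasFDerivAt (closedSlab_mem_nhds hp)

theorem hasFDerivAt (J : SlabJet t w) {p : Spacetime} (hp : p ∈ openSlab t) :
    HasFDerivAt w (J.d1 p) p :=
  (J.hasFDerivWithinAt p (openSlab_subset t hp)).hasFDerivAt (closedSlab_mem_nhds hp)

theorem d2_symm (J : SlabJet t w) {p : Spacetime} (hp : p ∈ openSlab t) (u v : Spacetime) :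
    J.d2 p u v = J.d2 p v u :=
  second_derivative_symmetric_of_eventually
    (Filter.eventually_of_mem ((isOpen_openSlab t).mem_nhds hp) fun _ hq => J.hasFDerivAt hq)
    (J.hasFDerivAt_d1 p hp) u v

/-- The d'Alembertian read off from the second derivative. -/
noncomputable def wave (J : SlabJet t w) (p : Spacetime) : ℝ :=
  J.d2 p (1, 0) (1, 0) - ∑ i : Fin 3,
    J.d2 p (0, EuclideanSpace.single i 1) (0, EuclideanSpace.single i 1)

theorem box_eq_wave (J : SlabJet t w) {p : Spacetime} (hp : p ∈ openSlab t) :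
    box w p = J.wave p := by
  have key : ∀ v : Spacetime, fderiv ℝ (fun q => fderiv ℝ w q v) p v = J.d2 p v v := by
    intro v
    have e : (fun q => fderiv ℝ w q v) =ᶠ[nhds p] fun q => J.d1 q v :=
      Filter.eventually_of_mem ((isOpen_openSlab t).mem_nhds hp) fun q hq => by
        simp only [(J.hasFDerivAt hq).fderiv]
    rw [e.fderiv_eq, ((J.hasFDerivAt_d1 p hp).clm_apply (hasFDerivAt_const v p)).fderiv]
    simp
  exact congrArg₂ _ (key _) (Finset.sum_congr rfl fun i _ => key _)

/-- This extends `box w` continuously to the faces of the slab, where `box` itself, built from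
`fderiv`, need not be meaningful. The scaling argument needs it at the origin. -/
theorem continuousOn_wave (J : SlabJet t w) : ContinuousOn J.wave (closedSlab t) := by
  have := J.continuousOn_d2
  unfold wave
  fun_prop

/-- The time component vanishes by uniqueness of one-sided derivatives, the spatial ones because
w(0,·) is identically zero. This kills the endpoint τ = t of the characteristics. -/
theorem d1_eq_zero (J : SlabJet t w) (ht : 0 < t) (h0 : ∀ x : 𝔼, w (0, x) = 0)
    (h1 : ∀ x : 𝔼, HasDerivWithinAt (fun s : ℝ => w (s, x)) 0 (Icc 0 t) 0) (x : 𝔼)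
    (v : Spacetime) : J.d1 (0, x) v = 0 := by
  have hmem : ((0 : ℝ), x) ∈ closedSlab t := mem_closedSlab.2 ⟨le_rfl, ht.le⟩
  have hw := J.hasFDerivWithinAt _ hmem
  have e1 : J.d1 (0, x) (1, 0) = 0 := by
    have hline : HasDerivWithinAt (fun s : ℝ => ((s, x) : Spacetime)) (1, 0) (Icc 0 t) 0 :=
      (hasDerivWithinAt_id 0 _).prodMk (hasDerivWithinAt_const 0 _ x)
    have := HasFDerivWithinAt.comp_hasDerivWithinAt (f := fun s : ℝ => ((s, x) : Spacetime))
      (0 : ℝ) hw hline fun s hs => mem_closedSlab.2 hs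
    exact (uniqueDiffOn_Icc ht 0 (left_mem_Icc.2 ht.le)).eq_deriv _ this (h1 x)
  have e2 : J.d1 (0, x) (0, v.2) = 0 := by
    have hι : HasFDerivAt (fun y : 𝔼 => ((0, y) : Spacetime)) (ContinuousLinearMap.inr ℝ ℝ 𝔼) x :=
      (ContinuousLinearMap.inr ℝ ℝ 𝔼).hasFDerivAt
    have hc : HasFDerivAt (w ∘ fun y : 𝔼 => ((0, y) : Spacetime))
        ((J.d1 (0, x)).comp (ContinuousLinearMap.inr ℝ ℝ 𝔼)) x := by
      rw [← hasFDerivWithinAt_univ] at hι ⊢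
      exact hw.comp x hι fun y _ => mem_closedSlab.2 ⟨le_rfl, ht.le⟩
    have hz : (w ∘ fun y : 𝔼 => ((0, y) : Spacetime)) = fun _ => 0 := funext h0
    rw [hz] at hc
    exact congrArg (fun T : 𝔼 →L[ℝ] ℝ => T v.2) (hc.unique (hasFDerivAt_const 0 x))
  have : v = v.1 • ((1, 0) : Spacetime) + (0, v.2) := by ext <;> simp
  rw [this, map_add, map_smul, e1, e2]
  simp

end SlabJet

/-! ### The moving spherical frame and the wave operator along characteristics. -/

section Frame

variable (b : OrthonormalBasis (Fin 3) ℝ 𝔼)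

/-- The equatorial unit vector with azimuth `φ`. -/
noncomputable def equator (φ : ℝ) : 𝔼 := Real.cos φ • b 1 + Real.sin φ • b 2

/-- The derivative of `sph` in the polar angle. -/
noncomputable def sphPolar (θ φ : ℝ) : 𝔼 :=
  -Real.sin θ • b 0 + Real.cos θ • equator b φ

/-- The unit vector in the azimuthal direction. -/
noncomputable def azimuthal (φ : ℝ) : 𝔼 := -Real.sin φ • b 1 + Real.cos φ • b 2

theorem sph_eq (θ φ : ℝ) : sph b θ φ = Real.cos θ • b 0 + Real.sin θ • equator b φ := rfl

variable {X : Type*} [TopologicalSpace X] {θ φ : X → ℝ}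

@[fun_prop]
theorem continuous_sph (hθ : Continuous θ) (hφ : Continuous φ) :
    Continuous fun z => sph b (θ z) (φ z) := by
  unfold sph; fun_prop

@[fun_prop]
theorem continuous_equator (hφ : Continuous φ) : Continuous fun z => equator b (φ z) := by
  unfold equator; fun_prop

@[fun_prop]
theorem continuous_sphPolar (hθ : Continuous θ) (hφ : Continuous φ) :
    Continuous fun z => sphPolar b (θ z) (φ z) := by
  unfold sphPolar; fun_prop

@[fun_prop]
theorem continuous_azimuthal (hφ : Continuous φ) : Continuous fun z => azimuthal b (φ z) := by
  unfold azimuthal; fun_prop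

theorem hasDerivAt_sph_polar (θ φ : ℝ) :
    HasDerivAt (fun θ => sph b θ φ) (sphPolar b θ φ) θ :=
  ((Real.hasDerivAt_cos θ).smul_const (b 0)).add
    ((Real.hasDerivAt_sin θ).smul_const (equator b φ))

theorem hasDerivAt_sphPolar (θ φ : ℝ) :
    HasDerivAt (fun θ => sphPolar b θ φ) (-sph b θ φ) θ := by
  have := ((Real.hasDerivAt_sin θ).neg.smul_const (b 0)).add
    ((Real.hasDerivAt_cos θ).smul_const (equator b φ))
  refine this.congr_deriv ?_
  rw [sph_eq]; module

theorem hasDerivAt_equator (φ : ℝ) : HasDerivAt (equator b) (azimuthal b φ) φ :=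
  ((Real.hasDerivAt_cos φ).smul_const (b 1)).add ((Real.hasDerivAt_sin φ).smul_const (b 2))

theorem hasDerivAt_azimuthal (φ : ℝ) : HasDerivAt (azimuthal b) (-equator b φ) φ := by
  have := ((Real.hasDerivAt_sin φ).neg.smul_const (b 1)).add
    ((Real.hasDerivAt_cos φ).smul_const (b 2))
  refine this.congr_deriv ?_
  rw [equator]; module

theorem hasDerivAt_sph_azimuth (θ φ : ℝ) :
    HasDerivAt (fun φ => sph b θ φ) (Real.sin θ • azimuthal b φ) φ :=
  ((hasDerivAt_equator b φ).const_smul (Real.sin θ)).const_add _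

theorem sin_smul_sph_add (θ φ : ℝ) :
    Real.sin θ • sph b θ φ + Real.cos θ • sphPolar b θ φ = equator b φ := by
  have : equator b φ = (Real.sin θ ^ 2 + Real.cos θ ^ 2) • equator b φ := by simp
  rw [this, sph_eq, sphPolar]; module

theorem norm_sph (θ φ : ℝ) : ‖sph b θ φ‖ = 1 := by
  have h : ‖sph b θ φ‖ ^ 2 = 1 := by
    have hb := b.orthonormal
    rw [orthonormal_iff_ite] at hb
    rw [← real_inner_self_eq_norm_sq, sph]
    simp only [inner_add_left, inner_add_right, inner_smul_left, inner_smul_right, hb]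
    simp
    linear_combination Real.sin_sq_add_cos_sq θ +
      Real.sin θ ^ 2 * Real.sin_sq_add_cos_sq φ
  nlinarith [norm_nonneg (sph b θ φ)]

/-- The trace of a bilinear form in the spherical frame. -/
theorem trace_spherical (D : 𝔼 →L[ℝ] 𝔼 →L[ℝ] ℝ) (θ φ : ℝ) :
    ∑ i, D (b i) (b i) = D (sph b θ φ) (sph b θ φ) + D (sphPolar b θ φ) (sphPolar b θ φ) +
      D (azimuthal b φ) (azimuthal b φ) := by
  have h1 : D (sph b θ φ) (sph b θ φ) + D (sphPolar b θ φ) (sphPolar b θ φ) =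
      D (b 0) (b 0) + D (equator b φ) (equator b φ) := by
    rw [sph_eq, sphPolar]
    simp only [map_add, map_smul, add_apply, smul_apply,
      smul_eq_mul]
    linear_combination (D (b 0) (b 0) + D (equator b φ) (equator b φ)) *
      Real.sin_sq_add_cos_sq θ
  have h2 : D (equator b φ) (equator b φ) + D (azimuthal b φ) (azimuthal b φ) =
      D (b 1) (b 1) + D (b 2) (b 2) := by
    rw [equator, azimuthal]
    simp only [map_add, map_smul, add_apply, smul_apply,
      smul_eq_mul]
    linear_combination (D (b 1) (b 1) + D (b 2) (b 2)) * Real.sin_sq_add_cos_sq φ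
  rw [Fin.sum_univ_three]
  linarith

/-- The derivative of `w + τ (∂_t + ∂_r) w` along a backward characteristic, up to divergences
on the sphere. -/
theorem characteristic_identity (D₁ : Spacetime →L[ℝ] ℝ)
    (D₂ : Spacetime →L[ℝ] Spacetime →L[ℝ] ℝ) (τ θ φ : ℝ)
    (hsym : D₂ (1, 0) (0, sph b θ φ) = D₂ (0, sph b θ φ) (1, 0)) :
    -(Real.sin θ * (D₁ (-1, sph b θ φ) + (D₁ (1, sph b θ φ) +
      τ * D₂ (-1, sph b θ φ) (1, sph b θ φ)))) =
    τ * Real.sin θ * (D₂ (1, 0) (1, 0) - ∑ i, D₂ (0, b i) (0, b i)) +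
    (Real.cos θ * D₁ (0, sphPolar b θ φ) +
      Real.sin θ * (D₂ (0, τ • sphPolar b θ φ) (0, sphPolar b θ φ) + D₁ (0, -sph b θ φ))) +
    (D₂ (0, τ • Real.sin θ • azimuthal b φ) (0, azimuthal b φ) + D₁ (0, -equator b φ)) := by
  have htr : ∑ i, D₂ (0, b i) (0, b i) = D₂ (0, sph b θ φ) (0, sph b θ φ) +
      D₂ (0, sphPolar b θ φ) (0, sphPolar b θ φ) + D₂ (0, azimuthal b φ) (0, azimuthal b φ) :=
    trace_spherical b (((ContinuousLinearMap.compL ℝ 𝔼 Spacetime ℝ).flip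
      (ContinuousLinearMap.inr ℝ ℝ 𝔼)).comp (D₂.comp (ContinuousLinearMap.inr ℝ ℝ 𝔼))) θ φ
  -- The term -2∂_r is shared equally: one half sits in the polar divergence, the other in the
  -- azimuthal one, and the two cos θ terms cancel.
  have heq : D₁ (0, -equator b φ) = -(Real.sin θ * D₁ (0, sph b θ φ) +
      Real.cos θ * D₁ (0, sphPolar b θ φ)) := by
    rw [← sin_smul_sph_add b θ φ, ← smul_eq_mul, ← smul_eq_mul, ← map_smul, ← map_smul,
      ← map_add, ← map_neg]
    simp
  have e1 : ((1, sph b θ φ) : Spacetime) = (1, 0) + (0, sph b θ φ) := by simp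
  have e2 : ((-1, sph b θ φ) : Spacetime) = -(1, 0) + (0, sph b θ φ) := by simp
  have e3 : ((0, -sph b θ φ) : Spacetime) = -(0, sph b θ φ) := by simp
  have e4 : ((0, τ • sphPolar b θ φ) : Spacetime) = τ • (0, sphPolar b θ φ) := by simp
  have e5 : ((0, τ • Real.sin θ • azimuthal b φ) : Spacetime) =
      τ • Real.sin θ • (0, azimuthal b φ) := by simp
  rw [htr, heq, e1, e2, e3, e4, e5]
  simp only [map_add, map_neg, map_smul, add_apply, neg_apply, smul_apply, smul_eq_mul, hsym]
  ring

end Frame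

/-! ### Kirchhoff's formula and the retarded potential. -/

/-- `|F|` on the open slab, extended by zero. -/
noncomputable def slabExt (t : ℝ) (F : Spacetime → ℝ) : Spacetime → ℝ≥0∞ :=
  (openSlab t).indicator fun p => ENNReal.ofReal |F p|

theorem slabExt_of_mem {t : ℝ} {F : Spacetime → ℝ} {p : Spacetime} (hp : p ∈ openSlab t) :
    slabExt t F p = ENNReal.ofReal |F p| := indicator_of_mem hp _

theorem slabExt_of_notMem {t : ℝ} {F : Spacetime → ℝ} {p : Spacetime} (hp : p ∉ openSlab t) :
    slabExt t F p = 0 := indicator_of_notMem hp _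

theorem measurable_slabExt {t : ℝ} {F : Spacetime → ℝ} (hF : ContinuousOn F (openSlab t)) :
    Measurable (slabExt t F) := by
  classical
  rw [slabExt, ← piecewise_eq_indicator]
  exact ContinuousOn.measurable_piecewise (ENNReal.continuous_ofReal.comp_continuousOn hF.abs)
    continuousOn_const (isOpen_openSlab t).measurableSet

theorem integral_swap_of_continuous {G : ℝ → ℝ → ℝ} (hG : Continuous fun z : ℝ × ℝ => G z.1 z.2)
    (a b c d : ℝ) :
    ∫ u in a..b, ∫ v in c..d, G u v = ∫ v in c..d, ∫ u in a..b, G u v := by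
  refine intervalIntegral_intervalIntegral_swap ?_
  have : IntegrableOn (Function.uncurry G) (uIcc a b ×ˢ uIcc c d) :=
    ContinuousOn.integrableOn_compact (isCompact_uIcc.prod isCompact_uIcc) hG.continuousOn
  exact this.mono_set (prod_mono uIoc_subset_uIcc uIoc_subset_uIcc)

theorem ofReal_abs_intervalIntegral_le (f : ℝ → ℝ) {a b : ℝ} (hab : a ≤ b) :
    ENNReal.ofReal |∫ x in a..b, f x| ≤ ∫⁻ x in Ioo a b, ENNReal.ofReal |f x| := by
  rw [intervalIntegral.integral_of_le hab, integral_Ioc_eq_integral_Ioo]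
  have := enorm_integral_le_lintegral_enorm (μ := volume.restrict (Ioo a b)) f
  simpa [Real.enorm_eq_ofReal_abs] using this

namespace SlabJet

variable {t : ℝ} {w : Spacetime → ℝ}

/-- Kirchhoff's formula in spherical coordinates. -/
theorem kirchhoff (J : SlabJet t w) (ht : 0 < t) (h0 : ∀ x : 𝔼, w (0, x) = 0)
    (h1 : ∀ x : 𝔼, HasDerivWithinAt (fun s : ℝ => w (s, x)) 0 (Icc 0 t) 0) (x : 𝔼) :
    ENNReal.ofReal (4 * Real.pi * |w (t, x)|) ≤
      ∫⁻ τ in Ioo 0 t, ∫⁻ φ in Ioo (-Real.pi) Real.pi, ∫⁻ θ in Ioo 0 Real.pi,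
        ENNReal.ofReal |τ * Real.sin θ *
          J.wave (t - τ, x + τ • sph (EuclideanSpace.basisFun (Fin 3) ℝ) θ φ)| := by
  set b := EuclideanSpace.basisFun (Fin 3) ℝ with hb
  -- Clamping τ to [0,t] keeps the characteristic in the closed slab, so that all integrands are
  -- continuous on the whole space.
  set c : ℝ → ℝ := fun τ => max 0 (min τ t) with hc
  have cc : Continuous c := by fun_prop
  have hcI : ∀ τ ∈ Icc 0 t, c τ = τ := fun τ hτ => by simp [hc, hτ.1, hτ.2]
  set q : ℝ → ℝ → ℝ → Spacetime := fun τ φ θ => (t - c τ, x + c τ • sph b θ φ) with hq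
  have cq : Continuous fun z : ℝ × ℝ × ℝ => q z.1 z.2.1 z.2.2 := by fun_prop
  have hqS : ∀ τ φ θ, q τ φ θ ∈ closedSlab t := by
    intro τ φ θ
    rw [mem_closedSlab]
    have h1 : 0 ≤ c τ := le_max_left _ _
    have h2 : c τ ≤ t := max_le ht.le (min_le_right _ _)
    constructor <;> simp only [hq] <;> linarith
  have hqU : ∀ τ ∈ Ioo 0 t, ∀ φ θ, q τ φ θ ∈ openSlab t := by
    intro τ hτ φ θ
    rw [mem_openSlab]
    simp only [hq, hcI τ (Ioo_subset_Icc_self hτ)]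
    constructor <;> linarith [hτ.1, hτ.2]
  have c1 : Continuous fun z : ℝ × ℝ × ℝ => J.d1 (q z.1 z.2.1 z.2.2) :=
    J.continuousOn_d1.comp_continuous cq fun z => hqS _ _ _
  have c2 : Continuous fun z : ℝ × ℝ × ℝ => J.d2 (q z.1 z.2.1 z.2.2) :=
    J.continuousOn_d2.comp_continuous cq fun z => hqS _ _ _
  have cw : Continuous fun z : ℝ × ℝ × ℝ => J.wave (q z.1 z.2.1 z.2.2) :=
    J.continuousOn_wave.comp_continuous cq fun z => hqS _ _ _
  set K : ℝ → ℝ → ℝ → ℝ := fun τ φ θ => c τ * Real.sin θ * J.wave (q τ φ θ) with hK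
  set P : ℝ → ℝ → ℝ → ℝ := fun τ φ θ =>
    Real.cos θ * J.d1 (q τ φ θ) (0, sphPolar b θ φ) +
    Real.sin θ * (J.d2 (q τ φ θ) (0, c τ • sphPolar b θ φ) (0, sphPolar b θ φ) +
      J.d1 (q τ φ θ) (0, -sph b θ φ)) with hP
  set A : ℝ → ℝ → ℝ → ℝ := fun τ φ θ =>
    J.d2 (q τ φ θ) (0, c τ • Real.sin θ • azimuthal b φ) (0, azimuthal b φ) +
      J.d1 (q τ φ θ) (0, -equator b φ) with hA
  have cK : Continuous fun z : ℝ × ℝ × ℝ => K z.1 z.2.1 z.2.2 := by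
    simp only [hK]; fun_prop
  have cP : Continuous fun z : ℝ × ℝ × ℝ => P z.1 z.2.1 z.2.2 := by
    simp only [hP]; fun_prop
  have cA : Continuous fun z : ℝ × ℝ × ℝ => A z.1 z.2.1 z.2.2 := by
    simp only [hA]; fun_prop
  -- A θ-derivative of a function carrying the factor sin θ, hence zero at both poles.
  have hP0 : ∀ τ ∈ Ioo 0 t, ∀ φ, ∫ θ in (0 : ℝ)..Real.pi, P τ φ θ = 0 := by
    intro τ hτ φ
    have hd : ∀ θ, HasDerivAt (fun θ => Real.sin θ * J.d1 (q τ φ θ) (0, sphPolar b θ φ))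
        (P τ φ θ) θ := by
      intro θ
      have hqd : HasDerivAt (fun θ => q τ φ θ) (0, c τ • sphPolar b θ φ) θ :=
        (hasDerivAt_const _ _).prodMk (((hasDerivAt_sph_polar b θ φ).const_smul (c τ)).const_add x)
      have hd1 := (J.hasFDerivAt_d1 _ (hqU τ hτ φ θ)).comp_hasDerivAt θ hqd
      exact (Real.hasDerivAt_sin θ).mul
        (hd1.clm_apply ((hasDerivAt_const θ (0 : ℝ)).prodMk (hasDerivAt_sphPolar b θ φ)))
    rw [intervalIntegral.integral_eq_sub_of_hasDerivAt (fun θ _ => hd θ)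
      ((cP.comp (by fun_prop : Continuous fun θ : ℝ => (τ, φ, θ))).intervalIntegrable _ _)]
    simp
  -- A φ-derivative of a 2π-periodic function.
  have hA0 : ∀ τ ∈ Ioo 0 t, ∀ θ, ∫ φ in (-Real.pi)..Real.pi, A τ φ θ = 0 := by
    intro τ hτ θ
    have hd : ∀ φ, HasDerivAt (fun φ => J.d1 (q τ φ θ) (0, azimuthal b φ)) (A τ φ θ) φ := by
      intro φ
      have hqd : HasDerivAt (fun φ => q τ φ θ) (0, c τ • Real.sin θ • azimuthal b φ) φ :=
        (hasDerivAt_const _ _).prodMk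
          (((hasDerivAt_sph_azimuth b θ φ).const_smul (c τ)).const_add x)
      have hd1 := (J.hasFDerivAt_d1 _ (hqU τ hτ φ θ)).comp_hasDerivAt φ hqd
      exact hd1.clm_apply ((hasDerivAt_const φ (0 : ℝ)).prodMk (hasDerivAt_azimuthal b φ))
    rw [intervalIntegral.integral_eq_sub_of_hasDerivAt (fun φ _ => hd φ)
      ((cA.comp (by fun_prop : Continuous fun φ : ℝ => (τ, φ, θ))).intervalIntegrable _ _)]
    simp [hq, sph, azimuthal]
  -- The fundamental theorem of calculus along one characteristic: the end τ = t lies on the initial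
  -- hyperplane and contributes zero.
  have hray : ∀ φ θ, ∫ τ in (0 : ℝ)..t, (K τ φ θ + P τ φ θ + A τ φ θ) =
      Real.sin θ * w (t, x) := by
    intro φ θ
    have hcont : ContinuousOn (fun τ => -(Real.sin θ *
        (w (q τ φ θ) + c τ * J.d1 (q τ φ θ) (1, sph b θ φ)))) (Icc 0 t) := by
      have e1 : Continuous fun τ => w (q τ φ θ) :=
        J.continuousOn.comp_continuous (cq.comp (by fun_prop : Continuous fun τ : ℝ => (τ, φ, θ)))
          fun _ => hqS _ _ _
      have e2 : Continuous fun τ => J.d1 (q τ φ θ) :=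
        c1.comp (by fun_prop : Continuous fun τ : ℝ => (τ, φ, θ))
      exact (continuous_const.mul (e1.add (cc.mul (e2.clm_apply continuous_const)))).neg.continuousOn
    have hder : ∀ τ ∈ Ioo 0 t, HasDerivAt (fun τ => -(Real.sin θ *
        (w (q τ φ θ) + c τ * J.d1 (q τ φ θ) (1, sph b θ φ))))
        (K τ φ θ + P τ φ θ + A τ φ θ) τ := by
      intro τ hτ
      have hev : ∀ᶠ σ in nhds τ, c σ = σ :=
        Filter.eventually_of_mem (isOpen_Ioo.mem_nhds hτ) fun σ hσ =>
          hcI σ (Ioo_subset_Icc_self hσ)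
      have hcd : HasDerivAt c 1 τ := (hasDerivAt_id τ).congr_of_eventuallyEq hev
      have hqd : HasDerivAt (fun τ => q τ φ θ) (-1, (1 : ℝ) • sph b θ φ) τ :=
        (hcd.const_sub t).prodMk ((hcd.smul_const (sph b θ φ)).const_add x)
      have hU := hqU τ hτ φ θ
      have hd1 := (J.hasFDerivAt_d1 _ hU).comp_hasDerivAt τ hqd
      have hd0 := (J.hasFDerivAt hU).comp_hasDerivAt τ hqd
      have := ((hd0.add (hcd.mul (hd1.clm_apply
        (hasDerivAt_const τ ((1 : ℝ), sph b θ φ))))).const_mul (Real.sin θ)).neg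
      refine this.congr_deriv ?_
      have hid := characteristic_identity b (J.d1 (q τ φ θ)) (J.d2 (q τ φ θ)) (c τ) θ φ
        (J.d2_symm hU _ _)
      simp only [one_smul, one_mul, map_zero, add_zero] at hid ⊢
      rw [Function.comp_apply, hid]
      simp [hK, hP, hA, wave, hb]
    rw [intervalIntegral.integral_eq_sub_of_hasDerivAt_of_le ht.le hcont hder
      (Continuous.intervalIntegrable (by
        have e0 : Continuous fun τ => K τ φ θ :=
          cK.comp (by fun_prop : Continuous fun τ : ℝ => (τ, φ, θ))
        have e1 : Continuous fun τ => P τ φ θ :=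
          cP.comp (by fun_prop : Continuous fun τ : ℝ => (τ, φ, θ))
        have e2 : Continuous fun τ => A τ φ θ :=
          cA.comp (by fun_prop : Continuous fun τ : ℝ => (τ, φ, θ))
        exact (e0.add e1).add e2) _ _)]
    simp only [hq, hcI 0 ⟨le_rfl, ht.le⟩, hcI t ⟨ht.le, le_rfl⟩, sub_self, sub_zero, zero_smul,
      add_zero, h0, J.d1_eq_zero ht h0 h1]
    ring
  have swap3 : ∀ G : ℝ → ℝ → ℝ → ℝ, (Continuous fun z : ℝ × ℝ × ℝ => G z.1 z.2.1 z.2.2) →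
      ∫ φ in (-Real.pi)..Real.pi, ∫ θ in (0 : ℝ)..Real.pi, ∫ τ in (0 : ℝ)..t, G τ φ θ =
      ∫ τ in (0 : ℝ)..t, ∫ φ in (-Real.pi)..Real.pi, ∫ θ in (0 : ℝ)..Real.pi, G τ φ θ := by
    intro G hG
    rw [← integral_swap_of_continuous (G := fun φ τ => ∫ θ in (0 : ℝ)..Real.pi, G τ φ θ)]
    · refine intervalIntegral.integral_congr fun φ _ => ?_
      exact integral_swap_of_continuous (G := fun θ τ => G τ φ θ)
        (hG.comp (by fun_prop : Continuous fun z : ℝ × ℝ => (z.2, φ, z.1))) _ _ _ _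
    · refine intervalIntegral.continuous_parametric_intervalIntegral_of_continuous'
        (f := fun (z : ℝ × ℝ) θ => G z.2 z.1 θ) ?_ _ _
      exact hG.comp (by fun_prop : Continuous fun z : (ℝ × ℝ) × ℝ => (z.1.2, z.1.1, z.2))
  have hsum : ∫ τ in (0 : ℝ)..t, ∫ φ in (-Real.pi)..Real.pi, ∫ θ in (0 : ℝ)..Real.pi, K τ φ θ =
      4 * Real.pi * w (t, x) := by
    have e := swap3 (fun τ φ θ => K τ φ θ + P τ φ θ + A τ φ θ) (by fun_prop)
    simp only [hray] at e
    have e1 : ∫ φ in (-Real.pi)..Real.pi, ∫ θ in (0 : ℝ)..Real.pi, Real.sin θ * w (t, x) =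
        4 * Real.pi * w (t, x) := by
      simp [intervalIntegral.integral_mul_const, integral_sin]
      ring
    rw [← e1, e]
    have i1 : ∀ (G : ℝ → ℝ → ℝ → ℝ), (Continuous fun z : ℝ × ℝ × ℝ => G z.1 z.2.1 z.2.2) →
        ∀ τ φ, IntervalIntegrable (fun θ => G τ φ θ) volume 0 Real.pi := fun G hG τ φ =>
      (hG.comp (by fun_prop : Continuous fun θ : ℝ => (τ, φ, θ))).intervalIntegrable _ _
    have i2 : ∀ (G : ℝ → ℝ → ℝ → ℝ), (Continuous fun z : ℝ × ℝ × ℝ => G z.1 z.2.1 z.2.2) →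
        ∀ τ, IntervalIntegrable (fun φ => ∫ θ in (0 : ℝ)..Real.pi, G τ φ θ) volume
          (-Real.pi) Real.pi := fun G hG τ => by
      refine Continuous.intervalIntegrable
        (intervalIntegral.continuous_parametric_intervalIntegral_of_continuous'
          (f := fun φ θ => G τ φ θ) ?_ _ _) _ _
      exact hG.comp (by fun_prop : Continuous fun z : ℝ × ℝ => (τ, z.1, z.2))
    rw [intervalIntegral.integral_of_le ht.le, intervalIntegral.integral_of_le ht.le,
      integral_Ioc_eq_integral_Ioo, integral_Ioc_eq_integral_Ioo]
    refine setIntegral_congr_fun measurableSet_Ioo fun τ hτ => ?_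
    have e2 : ∀ φ, ∫ θ in (0 : ℝ)..Real.pi, (K τ φ θ + P τ φ θ + A τ φ θ) =
        (∫ θ in (0 : ℝ)..Real.pi, K τ φ θ) + ∫ θ in (0 : ℝ)..Real.pi, A τ φ θ := by
      intro φ
      rw [intervalIntegral.integral_add ((i1 K cK τ φ).add (i1 P cP τ φ)) (i1 A cA τ φ),
        intervalIntegral.integral_add (i1 K cK τ φ) (i1 P cP τ φ), hP0 τ hτ φ, add_zero]
    have e3 : ∫ φ in (-Real.pi)..Real.pi, ∫ θ in (0 : ℝ)..Real.pi, A τ φ θ = 0 := by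
      rw [integral_swap_of_continuous
        (cA.comp (by fun_prop : Continuous fun z : ℝ × ℝ => (τ, z.1, z.2)))]
      simp [hA0 τ hτ]
    simp only [e2]
    rw [intervalIntegral.integral_add (i2 K cK τ) (i2 A cA τ), e3, add_zero]
  have habs : 4 * Real.pi * |w (t, x)| = |4 * Real.pi * w (t, x)| := by
    rw [abs_mul, abs_of_pos (show 0 < 4 * Real.pi by positivity)]
  rw [habs, ← hsum]
  refine (ofReal_abs_intervalIntegral_le _ ht.le).trans ?_
  refine setLIntegral_mono' measurableSet_Ioo fun τ hτ => ?_
  refine (ofReal_abs_intervalIntegral_le _ (by linarith [Real.pi_pos])).trans ?_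
  refine lintegral_mono fun φ => ?_
  refine (ofReal_abs_intervalIntegral_le _ Real.pi_pos.le).trans (le_of_eq ?_)
  simp only [hK, hq, hcI τ (Ioo_subset_Icc_self hτ)]

/-- The retarded potential bounds the solution with vanishing Cauchy data. -/
theorem retarded_le (J : SlabJet t w) (ht : 0 < t) (h0 : ∀ x : 𝔼, w (0, x) = 0)
    (h1 : ∀ x : 𝔼, HasDerivWithinAt (fun s : ℝ => w (s, x)) 0 (Icc 0 t) 0)
    {F : Spacetime → ℝ} (hF : ∀ p ∈ openSlab t, box w p = F p) (x : 𝔼) :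
    ENNReal.ofReal |w (t, x)| ≤
      ∫⁻ y : 𝔼, slabExt t F (t - ‖y‖, x + y) * ENNReal.ofReal ‖y‖⁻¹ := by
  have hFw : ∀ p ∈ openSlab t, F p = J.wave p := fun p hp => by rw [← hF p hp, J.box_eq_wave hp]
  have hFc : ContinuousOn F (openSlab t) :=
    (J.continuousOn_wave.mono (openSlab_subset t)).congr hFw
  have hm : Measurable fun y : 𝔼 => slabExt t F (t - ‖y‖, x + y) * ENNReal.ofReal ‖y‖⁻¹ :=
    ((measurable_slabExt hFc).comp (by fun_prop)).mul (by fun_prop)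
  -- The factor 1/(4π) of Kirchhoff's formula is given away.
  have hle : ENNReal.ofReal |w (t, x)| ≤ ENNReal.ofReal (4 * Real.pi * |w (t, x)|) := by
    refine ENNReal.ofReal_le_ofReal ?_
    nlinarith [Real.pi_gt_three, abs_nonneg (w (t, x))]
  refine (hle.trans (J.kirchhoff ht h0 h1 x)).trans ?_
  rw [lintegral_spherical (EuclideanSpace.basisFun (Fin 3) ℝ) hm]
  refine (setLIntegral_mono' measurableSet_Ioo fun τ hτ => ?_).trans
    (lintegral_mono_set Ioo_subset_Ioi_self)
  refine lintegral_mono fun φ => setLIntegral_mono' measurableSet_Ioo fun θ hθ => ?_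
  have hs : 0 ≤ Real.sin θ := Real.sin_nonneg_of_nonneg_of_le_pi hθ.1.le hθ.2.le
  have hn : ‖τ • sph (EuclideanSpace.basisFun (Fin 3) ℝ) θ φ‖ = τ := by
    rw [norm_smul, norm_sph, mul_one, Real.norm_of_nonneg hτ.1.le]
  have hU : ((t - τ, x + τ • sph (EuclideanSpace.basisFun (Fin 3) ℝ) θ φ) : Spacetime) ∈
      openSlab t := mem_openSlab.2 ⟨by simp [hτ.2], by simp [hτ.1]⟩
  rw [hn, slabExt_of_mem hU, hFw _ hU, abs_mul, abs_of_nonneg (mul_nonneg hτ.1.le hs),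
    ← ENNReal.ofReal_mul (abs_nonneg _), ← ENNReal.ofReal_mul (by positivity)]
  refine ENNReal.ofReal_le_ofReal (le_of_eq ?_)
  have := hτ.1.ne'
  field_simp

end SlabJet

/-! ### Rotation generators and the fields Z. -/

/-- The generator of the rotations in the plane of `e` and `m`, acting on space-time. -/
noncomputable def rotGen (e m : 𝔼) : Spacetime →L[ℝ] Spacetime :=
  (ContinuousLinearMap.inr ℝ ℝ 𝔼).comp
    (((innerSL ℝ e).smulRight m - (innerSL ℝ m).smulRight e).comp
      (ContinuousLinearMap.snd ℝ ℝ 𝔼))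

theorem rotGen_apply (e m : 𝔼) (p : Spacetime) :
    rotGen e m p = (0, inner ℝ e p.2 • m - inner ℝ m p.2 • e) := by
  simp [rotGen]

/-- The generators of the rotations in the coordinate planes. -/
noncomputable def axisGen : Fin 3 → Spacetime →L[ℝ] Spacetime :=
  ![rotGen (EuclideanSpace.single 0 1) (EuclideanSpace.single 1 1),
    rotGen (EuclideanSpace.single 0 1) (EuclideanSpace.single 2 1),
    rotGen (EuclideanSpace.single 1 1) (EuclideanSpace.single 2 1)]

/-- The components of `e ∧ m`. -/
def wedge (e m : 𝔼) : Fin 3 → ℝ :=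
  ![e 0 * m 1 - e 1 * m 0, e 0 * m 2 - e 2 * m 0, e 1 * m 2 - e 2 * m 1]

/-- The polar frame is adapted to x, whereas the given fields rotate coordinate planes. Rotation in
any plane is a combination of these with constant coefficients, the coordinates of e ∧ m. -/
theorem rotGen_eq_sum (e m : 𝔼) : rotGen e m = ∑ a, wedge e m a • axisGen a := by
  refine ContinuousLinearMap.ext fun p => ?_
  ext i
  · simp [rotGen_apply, Fin.sum_univ_three, wedge, axisGen]
  · fin_cases i <;>
      simp [rotGen_apply, Fin.sum_univ_three, wedge, axisGen, PiLp.inner_apply] <;> ring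

theorem abs_wedge_le {e m : 𝔼} (he : ‖e‖ ≤ 1) (hm : ‖m‖ ≤ 1) (a : Fin 3) :
    |wedge e m a| ≤ 2 := by
  have h1 : ∀ i, |e i| ≤ 1 := fun i => (PiLp.norm_apply_le e i).trans he
  have h2 : ∀ i, |m i| ≤ 1 := fun i => (PiLp.norm_apply_le m i).trans hm
  have h3 : ∀ i j, |e i * m j - e j * m i| ≤ 2 := fun i j => by
    refine (abs_sub _ _).trans ?_
    rw [abs_mul, abs_mul]
    nlinarith [h1 i, h1 j, h2 i, h2 j, abs_nonneg (e i), abs_nonneg (e j), abs_nonneg (m i),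
      abs_nonneg (m j)]
  fin_cases a <;> exact h3 _ _

/-- The relations of so(3): exchanging two distinct coordinate rotations costs only a third one. -/
theorem axisGen_commutator (p : Spacetime) :
    axisGen 1 (axisGen 0 p) = axisGen 0 (axisGen 1 p) - axisGen 2 p ∧
    axisGen 2 (axisGen 0 p) = axisGen 0 (axisGen 2 p) + axisGen 1 p ∧
    axisGen 2 (axisGen 1 p) = axisGen 1 (axisGen 2 p) - axisGen 0 p := by
  refine ⟨?_, ?_, ?_⟩ <;>
  · ext i
    · simp [axisGen, rotGen_apply]
    · fin_cases i <;> simp [axisGen, rotGen_apply, PiLp.inner_apply]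

theorem rot_apply (i j : Fin 3) (f : Spacetime → ℝ) (p : Spacetime) :
    rot i j f p =
      fderiv ℝ f p (rotGen (EuclideanSpace.single i 1) (EuclideanSpace.single j 1) p) := by
  have : rotGen (EuclideanSpace.single i 1) (EuclideanSpace.single j 1) p =
      p.2 i • ((0, EuclideanSpace.single j 1) : Spacetime) -
        p.2 j • ((0, EuclideanSpace.single i 1) : Spacetime) := by
    simp [rotGen_apply, EuclideanSpace.inner_single_left]
  rw [this, map_sub, map_smul, map_smul]
  rfl

theorem scaling_apply (f : Spacetime → ℝ) (p : Spacetime) : scaling f p = fderiv ℝ f p p := by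
  have : p = p.1 • ((1, 0) : Spacetime) +
      ∑ i : Fin 3, p.2 i • ((0, EuclideanSpace.single i 1) : Spacetime) := by
    ext i
    · simp [Prod.fst_sum]
    · fin_cases i <;> simp [Fin.sum_univ_three]
  conv_rhs => enter [2]; rw [this]
  simp only [scaling, dt, dx, map_add, map_sum, map_smul, smul_eq_mul]

/-- The position of a rotation field in the list of the fields `Z`. -/
def rotIndex (a : Fin 3) : Fin 7 := ⟨a + 4, by omega⟩

theorem Z_rotIndex (a : Fin 3) (f : Spacetime → ℝ) (p : Spacetime) :
    Z (rotIndex a) f p = fderiv ℝ f p (axisGen a p) := by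
  fin_cases a <;> exact rot_apply _ _ _ _

/-- The position of a spatial translation in the list of the fields `Z`. -/
def dxIndex (i : Fin 3) : Fin 7 := ⟨i + 1, by omega⟩

theorem Z_dxIndex (i : Fin 3) : Z (dxIndex i) = dx i := by
  fin_cases i <;> rfl

theorem abs_le_fieldSum (F : Spacetime → ℝ) (p : Spacetime) {j : ℕ} {α : Fin 7 → ℕ}
    (h : j ≤ 1 ∧ (∑ i, α i) + j ≤ 3) : |(scaling^[j] (Zpow α F)) p| ≤ fieldSum F p :=
  Finset.single_le_sum (f := fun q : ℕ × (Fin 7 → ℕ) => |(scaling^[q.1] (Zpow q.2 F)) p|)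
    (fun _ _ => abs_nonneg _) ((mem_indexSet j α).2 h)

theorem fieldSum_nonneg (F : Spacetime → ℝ) (p : Spacetime) : 0 ≤ fieldSum F p :=
  Finset.sum_nonneg fun _ _ => abs_nonneg _

theorem Zpow_single (a : Fin 7) (F : Spacetime → ℝ) : Zpow (Pi.single a 1) F = Z a F := by
  fin_cases a <;> rfl

/-- Multi-indices record products in the listed order only, so the opposite order has to be
recovered by commutators. -/
theorem Zpow_single_add_single {a b : Fin 7} (hab : a ≤ b) (F : Spacetime → ℝ) :
    Zpow (Pi.single a 1 + Pi.single b 1) F = Z a (Z b F) := by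
  fin_cases a <;> fin_cases b <;> first | rfl | exact absurd hab (by decide)

theorem abs_self_le_fieldSum (F : Spacetime → ℝ) (p : Spacetime) : |F p| ≤ fieldSum F p :=
  abs_le_fieldSum F p (j := 0) (α := 0) (by simp)

theorem abs_scaling_le_fieldSum (F : Spacetime → ℝ) (p : Spacetime) :
    |scaling F p| ≤ fieldSum F p :=
  abs_le_fieldSum F p (j := 1) (α := 0) (by simp)

theorem abs_Z_le_fieldSum (F : Spacetime → ℝ) (p : Spacetime) (a : Fin 7) :
    |Z a F p| ≤ fieldSum F p := by
  have := abs_le_fieldSum F p (j := 0) (α := Pi.single a 1) (by simp)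
  rwa [Zpow_single] at this

theorem abs_scaling_Z_le_fieldSum (F : Spacetime → ℝ) (p : Spacetime) (a : Fin 7) :
    |scaling (Z a F) p| ≤ fieldSum F p := by
  have := abs_le_fieldSum F p (j := 1) (α := Pi.single a 1) (by simp)
  rwa [Zpow_single] at this

theorem abs_Z_Z_le_fieldSum (F : Spacetime → ℝ) (p : Spacetime) {a b : Fin 7} (hab : a ≤ b) :
    |Z a (Z b F) p| ≤ fieldSum F p := by
  have := abs_le_fieldSum F p (j := 0) (α := Pi.single a 1 + Pi.single b 1)
    (by simp [Finset.sum_add_distrib])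
  rwa [Zpow_single_add_single hab] at this

/-! ### Measurability, and derivatives of the source in terms of the field sum. -/

section Slab

variable {t : ℝ}

theorem measurable_dt (f : Spacetime → ℝ) : Measurable (dt f) :=
  measurable_fderiv_apply_const ℝ f _

theorem measurable_dx (i : Fin 3) (f : Spacetime → ℝ) : Measurable (dx i f) :=
  measurable_fderiv_apply_const ℝ f _

theorem measurable_rot (i j : Fin 3) (f : Spacetime → ℝ) : Measurable (rot i j f) := by
  have h1 := measurable_dx i f
  have h2 := measurable_dx j f
  unfold rot
  fun_prop

theorem measurable_scaling (f : Spacetime → ℝ) : Measurable (scaling f) := by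
  have h1 := measurable_dt f
  have h2 := fun i => measurable_dx i f
  unfold scaling
  fun_prop

theorem measurable_Z (i : Fin 7) (f : Spacetime → ℝ) : Measurable (Z i f) := by
  fin_cases i
  exacts [measurable_dt f, measurable_dx 0 f, measurable_dx 1 f, measurable_dx 2 f,
    measurable_rot 0 1 f, measurable_rot 0 2 f, measurable_rot 1 2 f]

/-- A field applied to an arbitrary function is measurable, since `fderiv` is; only the case of no
field at all needs the hypothesis on f. -/
theorem measurable_indicator_iterate {X : (Spacetime → ℝ) → Spacetime → ℝ}
    (hX : ∀ f, Measurable (X f)) {f : Spacetime → ℝ} (hf : Measurable ((openSlab t).indicator f))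
    (n : ℕ) : Measurable ((openSlab t).indicator (X^[n] f)) := by
  cases n with
  | zero => exact hf
  | succ n =>
    rw [Function.iterate_succ_apply']
    exact (hX _).indicator (isOpen_openSlab t).measurableSet

theorem measurable_slabExt_fieldSum {F : Spacetime → ℝ} (hF : ContinuousOn F (openSlab t)) :
    Measurable (slabExt t (fieldSum F)) := by
  have h0 : Measurable ((openSlab t).indicator F) := by
    classical
    rw [← piecewise_eq_indicator]
    exact hF.measurable_piecewise continuousOn_const (isOpen_openSlab t).measurableSet
  have h1 : ∀ q : ℕ × (Fin 7 → ℕ),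
      Measurable ((openSlab t).indicator (scaling^[q.1] (Zpow q.2 F))) := fun q =>
    measurable_indicator_iterate measurable_scaling (by
      unfold Zpow
      iterate 7 refine measurable_indicator_iterate (measurable_Z _) ?_ _
      exact h0) _
  have h2 : slabExt t (fieldSum F) = fun p => ENNReal.ofReal (∑ q ∈ indexSet,
      |(openSlab t).indicator (scaling^[q.1] (Zpow q.2 F)) p|) := by
    funext p
    by_cases hp : p ∈ openSlab t
    · simp only [slabExt_of_mem hp, abs_of_nonneg (fieldSum_nonneg F p), indicator_of_mem hp]
      rfl
    · simp [slabExt_of_notMem hp, indicator_of_notMem hp]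
  rw [h2]
  fun_prop

variable {F : Spacetime → ℝ} {p : Spacetime}

theorem contDiffAt_of_slab {n : WithTop ℕ∞} (hF : ContDiffOn ℝ n F (openSlab t))
    (hp : p ∈ openSlab t) : ContDiffAt ℝ n F p :=
  hF.contDiffAt ((isOpen_openSlab t).mem_nhds hp)

theorem hasFDerivAt_fderiv (hF : ContDiffAt ℝ 2 F p) :
    HasFDerivAt (fderiv ℝ F) (fderiv ℝ (fderiv ℝ F) p) p :=
  ((hF.fderiv_right (m := 1) (by norm_num)).differentiableAt (by norm_num)).hasFDerivAt

theorem fderiv_fderiv_apply (hF : ContDiffAt ℝ 2 F p) {b : Spacetime → Spacetime}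
    {b' : Spacetime →L[ℝ] Spacetime} (hb : HasFDerivAt b b' p) (v : Spacetime) :
    fderiv ℝ (fun q => fderiv ℝ F q (b q)) p v =
      fderiv ℝ (fderiv ℝ F) p v (b p) + fderiv ℝ F p (b' v) := by
  rw [((hasFDerivAt_fderiv hF).clm_apply hb).fderiv]
  simp [add_comm]

theorem fderiv_fderiv_symm (hF : ContDiffAt ℝ 2 F p) (u v : Spacetime) :
    fderiv ℝ (fderiv ℝ F) p u v = fderiv ℝ (fderiv ℝ F) p v u :=
  (hF.isSymmSndFDerivAt (by simp)).eq u v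

/-- Iterated rotation fields in coordinates. -/
theorem Z_Z_rotIndex (hF : ContDiffAt ℝ 2 F p) (a b : Fin 3) :
    Z (rotIndex a) (Z (rotIndex b) F) p =
      fderiv ℝ (fderiv ℝ F) p (axisGen a p) (axisGen b p) +
        fderiv ℝ F p (axisGen b (axisGen a p)) := by
  have : Z (rotIndex b) F = fun q => fderiv ℝ F q (axisGen b q) :=
    funext fun q => Z_rotIndex b F q
  rw [Z_rotIndex, this, fderiv_fderiv_apply hF (axisGen b).hasFDerivAt]

/-- For a ≤ b the product is one of the listed ones; otherwise it is a listed one plus a commutator,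
again a rotation or zero. Hence the factor 2. -/
theorem abs_rot_rot_le (hF : ContDiffAt ℝ 2 F p) (a b : Fin 3) :
    |fderiv ℝ (fderiv ℝ F) p (axisGen a p) (axisGen b p) +
        fderiv ℝ F p (axisGen b (axisGen a p))| ≤ 2 * fieldSum F p := by
  have h0 := fieldSum_nonneg F p
  rcases le_total a b with hab | hab
  · have hab' : rotIndex a ≤ rotIndex b := by simpa [rotIndex] using hab
    rw [← Z_Z_rotIndex hF]
    linarith [abs_Z_Z_le_fieldSum F p hab']
  · have hab' : rotIndex b ≤ rotIndex a := by simpa [rotIndex] using hab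
    have h1 := abs_Z_Z_le_fieldSum F p hab'
    rw [Z_Z_rotIndex hF, fderiv_fderiv_symm hF] at h1
    have h2 : |fderiv ℝ F p (axisGen b (axisGen a p)) -
        fderiv ℝ F p (axisGen a (axisGen b p))| ≤ fieldSum F p := by
      have h3 : ∀ c, |fderiv ℝ F p (axisGen c p)| ≤ fieldSum F p := fun c => by
        rw [← Z_rotIndex]; exact abs_Z_le_fieldSum F p _
      obtain ⟨e1, e2, e3⟩ := axisGen_commutator p
      fin_cases a <;> fin_cases b <;> first
        | exact absurd hab (by decide)
        | simpa using h0
        | simpa [e1] using h3 2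
        | simpa [e2] using h3 1
        | simpa [e3] using h3 0
    have e : fderiv ℝ (fderiv ℝ F) p (axisGen a p) (axisGen b p) +
        fderiv ℝ F p (axisGen b (axisGen a p)) =
        (fderiv ℝ (fderiv ℝ F) p (axisGen a p) (axisGen b p) +
          fderiv ℝ F p (axisGen a (axisGen b p))) +
        (fderiv ℝ F p (axisGen b (axisGen a p)) - fderiv ℝ F p (axisGen a (axisGen b p))) := by
      ring
    rw [e]
    linarith [abs_add_le (fderiv ℝ (fderiv ℝ F) p (axisGen a p) (axisGen b p) +
      fderiv ℝ F p (axisGen a (axisGen b p))) (fderiv ℝ F p (axisGen b (axisGen a p)) -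
      fderiv ℝ F p (axisGen a (axisGen b p)))]

variable {e m : 𝔼}

theorem abs_sum_wedge_le (he : ‖e‖ ≤ 1) (hm : ‖m‖ ≤ 1) {c : Fin 3 → ℝ} {M : ℝ}
    (hc : ∀ a, |c a| ≤ M) : |∑ a, wedge e m a * c a| ≤ 6 * M := by
  refine (Finset.abs_sum_le_sum_abs _ _).trans ?_
  have : ∀ a ∈ Finset.univ, |wedge e m a * c a| ≤ 2 * M := fun a _ => by
    rw [abs_mul]
    exact mul_le_mul (abs_wedge_le he hm a) (hc a) (abs_nonneg _) zero_le_two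
  refine (Finset.sum_le_sum this).trans ?_
  simp
  linarith

theorem abs_rotGen_le (he : ‖e‖ ≤ 1) (hm : ‖m‖ ≤ 1) :
    |fderiv ℝ F p (rotGen e m p)| ≤ 6 * fieldSum F p := by
  have : fderiv ℝ F p (rotGen e m p) = ∑ a, wedge e m a * fderiv ℝ F p (axisGen a p) := by
    rw [rotGen_eq_sum]; simp
  rw [this]
  refine abs_sum_wedge_le he hm fun a => ?_
  rw [← Z_rotIndex]; exact abs_Z_le_fieldSum F p _

/-- This is the second derivative of F along the rotation flow. Each expansion into coordinate
rotations costs 6 (three components of size at most 2), and the ordering costs 2. -/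
theorem abs_rotGen_rotGen_le (hF : ContDiffAt ℝ 2 F p) (he : ‖e‖ ≤ 1) (hm : ‖m‖ ≤ 1) :
    |fderiv ℝ (fderiv ℝ F) p (rotGen e m p) (rotGen e m p) +
      fderiv ℝ F p (rotGen e m (rotGen e m p))| ≤ 72 * fieldSum F p := by
  have : fderiv ℝ (fderiv ℝ F) p (rotGen e m p) (rotGen e m p) +
      fderiv ℝ F p (rotGen e m (rotGen e m p)) =
      ∑ a, wedge e m a * ∑ b, wedge e m b *
        (fderiv ℝ (fderiv ℝ F) p (axisGen a p) (axisGen b p) +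
        fderiv ℝ F p (axisGen b (axisGen a p))) := by
    rw [rotGen_eq_sum]
    simp [Fin.sum_univ_three]
    ring
  rw [this]
  have h := abs_sum_wedge_le (e := e) (m := m) he hm fun a =>
    abs_sum_wedge_le he hm fun b => abs_rot_rot_le hF a b
  linarith

/-- The source `3F + LF` of the scaled equation. -/
noncomputable def scaledSource (F : Spacetime → ℝ) : Spacetime → ℝ :=
  fun p => 3 * F p + scaling F p

theorem abs_scaledSource_le : |scaledSource F p| ≤ 4 * fieldSum F p := by
  have h1 := abs_self_le_fieldSum F p
  have h2 := abs_scaling_le_fieldSum F p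
  have h3 := abs_add_le (3 * F p) (scaling F p)
  rw [abs_mul, abs_of_pos (by norm_num : (0 : ℝ) < 3)] at h3
  unfold scaledSource
  linarith

theorem hasFDerivAt_scaledSource (hF : ContDiffAt ℝ 2 F p) :
    HasFDerivAt (scaledSource F) (fderiv ℝ (scaledSource F) p) p ∧
    ∀ v, fderiv ℝ (scaledSource F) p v =
      4 * fderiv ℝ F p v + fderiv ℝ (fderiv ℝ F) p v p := by
  have h1 : HasFDerivAt F (fderiv ℝ F p) p := (hF.differentiableAt (by norm_num)).hasFDerivAt
  have h2 := (hasFDerivAt_fderiv hF).clm_apply (hasFDerivAt_id p)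
  have e : scaledSource F = fun q => 3 * F q + fderiv ℝ F q (id q) :=
    funext fun q => by simp [scaledSource, scaling_apply]
  have h3 := (h1.const_mul 3).add h2
  have h4 := h3.congr_of_eventuallyEq (Filter.Eventually.of_forall (congrFun e))
  refine ⟨h4.differentiableAt.hasFDerivAt, fun v => ?_⟩
  rw [h4.fderiv]
  simp
  ring

/-- L commutes with rotations, so Ω(3F+LF) = 3ΩF + LΩF, with L outermost as in the field sum. -/
theorem abs_fderiv_scaledSource_rotGen_le (hF : ContDiffAt ℝ 2 F p) (he : ‖e‖ ≤ 1)
    (hm : ‖m‖ ≤ 1) : |fderiv ℝ (scaledSource F) p (rotGen e m p)| ≤ 24 * fieldSum F p := by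
  have : fderiv ℝ (scaledSource F) p (rotGen e m p) =
      ∑ a, wedge e m a * fderiv ℝ (scaledSource F) p (axisGen a p) := by
    rw [rotGen_eq_sum]; simp
  rw [this]
  have h := abs_sum_wedge_le (e := e) (m := m) he hm
    (c := fun a => fderiv ℝ (scaledSource F) p (axisGen a p)) (M := 4 * fieldSum F p)
    fun a => by
      have e1 : fderiv ℝ (scaledSource F) p (axisGen a p) =
          3 * Z (rotIndex a) F p + scaling (Z (rotIndex a) F) p := by
        have e2 : Z (rotIndex a) F = fun q => fderiv ℝ F q (axisGen a q) :=
          funext fun q => Z_rotIndex a F q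
        rw [(hasFDerivAt_scaledSource hF).2, scaling_apply, e2,
          fderiv_fderiv_apply hF (axisGen a).hasFDerivAt, fderiv_fderiv_symm hF]
        ring
      have h1 := abs_Z_le_fieldSum F p (rotIndex a)
      have h2 := abs_scaling_Z_le_fieldSum F p (rotIndex a)
      have h3 := abs_add_le (3 * Z (rotIndex a) F p) (scaling (Z (rotIndex a) F) p)
      rw [abs_mul, abs_of_pos (by norm_num : (0 : ℝ) < 3)] at h3
      rw [e1]
      linarith
  linarith

theorem sum_smul_single (u : 𝔼) :
    ((0, u) : Spacetime) = ∑ i : Fin 3, u i • ((0, EuclideanSpace.single i 1) : Spacetime) := by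
  ext i
  · simp [Prod.fst_sum]
  · fin_cases i <;> simp [Fin.sum_univ_three]

theorem abs_sum_coord_le {u : 𝔼} (hu : ‖u‖ ≤ 1) {c : Fin 3 → ℝ} {M : ℝ}
    (hc : ∀ a, |c a| ≤ M) : |∑ a, u a * c a| ≤ 3 * M := by
  refine (Finset.abs_sum_le_sum_abs _ _).trans ?_
  have : ∀ a ∈ Finset.univ, |u a * c a| ≤ 1 * M := fun a _ => by
    rw [abs_mul]
    exact mul_le_mul ((PiLp.norm_apply_le u a).trans hu) (hc a) (abs_nonneg _) zero_le_one
  refine (Finset.sum_le_sum this).trans ?_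
  simp

theorem abs_fderiv_space_le {u : 𝔼} (hu : ‖u‖ ≤ 1) :
    |fderiv ℝ F p (0, u)| ≤ 3 * fieldSum F p := by
  rw [sum_smul_single u, map_sum]
  simp only [map_smul, smul_eq_mul]
  refine abs_sum_coord_le hu fun i => ?_
  have := abs_Z_le_fieldSum F p (dxIndex i)
  rwa [Z_dxIndex] at this

theorem abs_fderiv_fderiv_space_le (hF : ContDiffAt ℝ 2 F p) {u : 𝔼} (hu : ‖u‖ ≤ 1) :
    |fderiv ℝ (fderiv ℝ F) p (0, u) (0, u)| ≤ 9 * fieldSum F p := by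
  have h1 : ∀ i j : Fin 3, |fderiv ℝ (fderiv ℝ F) p (0, EuclideanSpace.single i 1)
      (0, EuclideanSpace.single j 1)| ≤ fieldSum F p := by
    have h2 : ∀ i j : Fin 3, i ≤ j → |fderiv ℝ (fderiv ℝ F) p (0, EuclideanSpace.single i 1)
        (0, EuclideanSpace.single j 1)| ≤ fieldSum F p := by
      intro i j hij
      have h3 := abs_Z_Z_le_fieldSum F p (show dxIndex i ≤ dxIndex j by simpa [dxIndex] using hij)
      rw [Z_dxIndex, Z_dxIndex] at h3
      have h4 := fderiv_fderiv_apply hF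
        (hasFDerivAt_const ((0, EuclideanSpace.single j 1) : Spacetime) p)
        (0, EuclideanSpace.single i 1)
      rw [zero_apply, map_zero, add_zero] at h4
      rw [← h4]
      exact h3
    intro i j
    rcases le_total i j with h | h
    · exact h2 i j h
    · rw [fderiv_fderiv_symm hF]; exact h2 j i h
  have h5 : fderiv ℝ (fderiv ℝ F) p (0, u) (0, u) = ∑ i, u i * ∑ j, u j *
      fderiv ℝ (fderiv ℝ F) p (0, EuclideanSpace.single i 1) (0, EuclideanSpace.single j 1) := by
    rw [sum_smul_single u]
    simp only [map_add, map_smul, add_apply, smul_apply, smul_eq_mul, Fin.sum_univ_three]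
    ring
  rw [h5]
  have := abs_sum_coord_le hu fun i => abs_sum_coord_le hu fun j => h1 i j
  linarith

end Slab

/-! ### Pointwise and Hardy bounds for the source along meridians and rays. -/

section Curves

variable {t : ℝ} {F : Spacetime → ℝ}

theorem continuousOn_fderiv_slab (hF : ContDiffOn ℝ 2 F (openSlab t)) :
    ContinuousOn (fderiv ℝ F) (openSlab t) :=
  (hF.fderiv_of_isOpen (m := 1) (isOpen_openSlab t) (by norm_num)).continuousOn

theorem continuousOn_fderiv_fderiv_slab (hF : ContDiffOn ℝ 2 F (openSlab t)) :
    ContinuousOn (fderiv ℝ (fderiv ℝ F)) (openSlab t) :=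
  ((hF.fderiv_of_isOpen (m := 1) (isOpen_openSlab t) (by norm_num)).fderiv_of_isOpen (m := 0)
    (isOpen_openSlab t) (by norm_num)).continuousOn

theorem continuousOn_scaledSource (hF : ContDiffOn ℝ 2 F (openSlab t)) :
    ContinuousOn (scaledSource F) (openSlab t) := fun _ hp =>
  (hasFDerivAt_scaledSource (contDiffAt_of_slab hF hp)).1.continuousAt.continuousWithinAt

variable (b : OrthonormalBasis (Fin 3) ℝ 𝔼)

theorem inner_zero_sph (θ φ : ℝ) : inner ℝ (b 0) (sph b θ φ) = Real.cos θ := by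
  simp [sph, inner_add_right, inner_smul_right]

theorem inner_equator_sph (θ φ : ℝ) : inner ℝ (equator b φ) (sph b θ φ) = Real.sin θ := by
  simp [sph, equator, inner_add_right, inner_add_left, inner_smul_right, inner_smul_left]
  linear_combination Real.sin θ * Real.sin_sq_add_cos_sq φ

theorem norm_equator (φ : ℝ) : ‖equator b φ‖ = 1 := by
  have := norm_sph b (Real.pi / 2) φ
  rwa [sph_eq, Real.cos_pi_div_two, Real.sin_pi_div_two, zero_smul, one_smul, zero_add] at this

/-- With φ fixed, ∂_θ is one fixed rotation field, in the plane of `b 0` and the equatorial vector.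
So the one-variable inequalities on a meridian involve rotation fields only. -/
theorem rotGen_meridian (s r θ φ : ℝ) :
    rotGen (b 0) (equator b φ) (s, r • sph b θ φ) = (0, r • sphPolar b θ φ) := by
  rw [rotGen_apply]
  simp only [inner_smul_right, inner_zero_sph, inner_equator_sph, sphPolar]
  congr 1
  module

theorem hasDerivAt_meridian (s r θ φ : ℝ) :
    HasDerivAt (fun θ => ((s, r • sph b θ φ) : Spacetime))
      (rotGen (b 0) (equator b φ) (s, r • sph b θ φ)) θ := by
  rw [rotGen_meridian]
  exact (hasDerivAt_const _ _).prodMk ((hasDerivAt_sph_polar b θ φ).const_smul r)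

variable {b} {s : ℝ}

/-- On a meridian, the source is bounded pointwise by its angular derivatives. -/
theorem abs_le_lintegral_meridian (hF : ContDiffOn ℝ 2 F (openSlab t)) (hs : s ∈ Ioo 0 t)
    (r φ : ℝ) {θ : ℝ} (hθ : θ ∈ Ioo 0 Real.pi) :
    ENNReal.ofReal |F (s, r • sph b θ φ)| ≤ ∫⁻ ψ in Ioo 0 Real.pi,
      ENNReal.ofReal (316 * (fieldSum F (s, r • sph b ψ φ) * Real.sin ψ)) := by
  set q : ℝ → Spacetime := fun ψ => (s, r • sph b ψ φ) with hq
  set R := rotGen (b 0) (equator b φ) with hR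
  have hU : ∀ ψ, q ψ ∈ openSlab t := fun ψ => mem_openSlab.2 hs
  have hqd : ∀ ψ, HasDerivAt q (R (q ψ)) ψ := fun ψ => hasDerivAt_meridian b s r ψ φ
  have cq : Continuous q := by fun_prop
  have hC : ∀ ψ, ContDiffAt ℝ 2 F (q ψ) := fun ψ => contDiffAt_of_slab hF (hU ψ)
  have d1 : ∀ ψ, HasDerivAt (fun ψ => F (q ψ)) (fderiv ℝ F (q ψ) (R (q ψ))) ψ := fun ψ =>
    ((hC ψ).differentiableAt (by norm_num)).hasFDerivAt.comp_hasDerivAt ψ (hqd ψ)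
  have d2 : ∀ ψ, HasDerivAt (fun ψ => fderiv ℝ F (q ψ) (R (q ψ)))
      (fderiv ℝ (fderiv ℝ F) (q ψ) (R (q ψ)) (R (q ψ)) + fderiv ℝ F (q ψ) (R (R (q ψ)))) ψ :=
    fun ψ => ((hasFDerivAt_fderiv (hC ψ)).comp_hasDerivAt ψ (hqd ψ)).clm_apply
      (R.hasFDerivAt.comp_hasDerivAt ψ (hqd ψ))
  have c1 : Continuous fun ψ => fderiv ℝ F (q ψ) :=
    (continuousOn_fderiv_slab hF).comp_continuous cq hU
  have c2 : Continuous fun ψ => fderiv ℝ (fderiv ℝ F) (q ψ) :=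
    (continuousOn_fderiv_fderiv_slab hF).comp_continuous cq hU
  refine (abs_le_lintegral_sin d1 d2 (by fun_prop) hθ).trans ?_
  refine setLIntegral_mono' measurableSet_Ioo fun ψ hψ => ENNReal.ofReal_le_ofReal ?_
  have hsin : 0 ≤ Real.sin ψ := Real.sin_nonneg_of_nonneg_of_le_pi hψ.1.le hψ.2.le
  have he : ‖b 0‖ ≤ 1 := (b.norm_eq_one 0).le
  have hm : ‖equator b φ‖ ≤ 1 := (norm_equator b φ).le
  have e0 := abs_self_le_fieldSum F (q ψ)
  have e1 := abs_rotGen_le (F := F) (p := q ψ) he hm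
  have e2 := abs_rotGen_rotGen_le (hC ψ) he hm
  -- 79 = 1 + 6 + 72, for zero, one and two rotations.
  have : 4 * ((79 * fieldSum F (q ψ)) * Real.sin ψ) =
      316 * (fieldSum F (q ψ) * Real.sin ψ) := by ring
  rw [← this]
  gcongr
  linarith

/-- Hardy's inequality for the scaled source on a meridian. -/
theorem lintegral_scaledSource_meridian (hF : ContDiffOn ℝ 2 F (openSlab t)) (hs : s ∈ Ioo 0 t)
    (r φ : ℝ) :
    ∫⁻ θ in Ioo 0 Real.pi, ENNReal.ofReal |scaledSource F (s, r • sph b θ φ)| ≤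
      ∫⁻ ψ in Ioo 0 Real.pi,
        ENNReal.ofReal (56 * (fieldSum F (s, r • sph b ψ φ) * Real.sin ψ)) := by
  set q : ℝ → Spacetime := fun ψ => (s, r • sph b ψ φ) with hq
  set R := rotGen (b 0) (equator b φ) with hR
  have hU : ∀ ψ, q ψ ∈ openSlab t := fun ψ => mem_openSlab.2 hs
  have hqd : ∀ ψ, HasDerivAt q (R (q ψ)) ψ := fun ψ => hasDerivAt_meridian b s r ψ φ
  have cq : Continuous q := by fun_prop
  have hC : ∀ ψ, ContDiffAt ℝ 2 F (q ψ) := fun ψ => contDiffAt_of_slab hF (hU ψ)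
  have d1 : ∀ ψ, HasDerivAt (fun ψ => scaledSource F (q ψ))
      (fderiv ℝ (scaledSource F) (q ψ) (R (q ψ))) ψ := fun ψ =>
    (hasFDerivAt_scaledSource (hC ψ)).1.comp_hasDerivAt ψ (hqd ψ)
  have c1 : Continuous fun ψ => fderiv ℝ F (q ψ) :=
    (continuousOn_fderiv_slab hF).comp_continuous cq hU
  have c2 : Continuous fun ψ => fderiv ℝ (fderiv ℝ F) (q ψ) :=
    (continuousOn_fderiv_fderiv_slab hF).comp_continuous cq hU
  have c3 : Continuous fun ψ => fderiv ℝ (scaledSource F) (q ψ) (R (q ψ)) := by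
    simp_rw [fun ψ => (hasFDerivAt_scaledSource (hC ψ)).2]
    fun_prop
  refine (lintegral_abs_le_lintegral_sin d1 c3).trans ?_
  refine setLIntegral_mono' measurableSet_Ioo fun ψ hψ => ENNReal.ofReal_le_ofReal ?_
  have hsin : 0 ≤ Real.sin ψ := Real.sin_nonneg_of_nonneg_of_le_pi hψ.1.le hψ.2.le
  have e0 := abs_scaledSource_le (F := F) (p := q ψ)
  have e1 := abs_fderiv_scaledSource_rotGen_le (hC ψ) (b.norm_eq_one 0).le (norm_equator b φ).le
  -- 28 = 4 + 24, for the scaled source and its rotation derivative.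
  have : 2 * ((28 * fieldSum F (q ψ)) * Real.sin ψ) =
      56 * (fieldSum F (q ψ) * Real.sin ψ) := by ring
  rw [← this]
  gcongr
  linarith

/-- On a ray, the source is bounded pointwise by its translation derivatives. -/
theorem mul_abs_le_lintegral_ray (hF : ContDiffOn ℝ 2 F (openSlab t)) (hs : s ∈ Ioo 0 t)
    (x : 𝔼) {u : 𝔼} (hu : ‖u‖ ≤ 1) {τ : ℝ} (h0 : 0 ≤ τ) (h1 : τ ≤ 1) :
    ENNReal.ofReal (τ * |F (s, x + τ • u)|) ≤ ∫⁻ r in Ioo 0 2,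
      ENNReal.ofReal (65 * (r ^ 2 * fieldSum F (s, x + r • u))) := by
  set q : ℝ → Spacetime := fun r => (s, x + r • u) with hq
  have hU : ∀ r, q r ∈ openSlab t := fun r => mem_openSlab.2 hs
  have hqd : ∀ r, HasDerivAt q (0, u) r := fun r => by
    refine (hasDerivAt_const _ _).prodMk ?_
    simpa using ((hasDerivAt_id r).smul_const u).const_add x
  have cq : Continuous q := by fun_prop
  have hC : ∀ r, ContDiffAt ℝ 2 F (q r) := fun r => contDiffAt_of_slab hF (hU r)
  have d1 : ∀ r, HasDerivAt (fun r => F (q r)) (fderiv ℝ F (q r) (0, u)) r := fun r =>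
    ((hC r).differentiableAt (by norm_num)).hasFDerivAt.comp_hasDerivAt r (hqd r)
  have d2 : ∀ r, HasDerivAt (fun r => fderiv ℝ F (q r) (0, u))
      (fderiv ℝ (fderiv ℝ F) (q r) (0, u) (0, u)) r := fun r => by
    simpa using ((hasFDerivAt_fderiv (hC r)).comp_hasDerivAt r (hqd r)).clm_apply
      (hasDerivAt_const r ((0, u) : Spacetime))
  have c2 : Continuous fun r => fderiv ℝ (fderiv ℝ F) (q r) :=
    (continuousOn_fderiv_fderiv_slab hF).comp_continuous cq hU
  refine (mul_abs_le_lintegral_sq d1 d2 (by fun_prop) h0 h1).trans ?_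
  refine lintegral_mono fun r => ENNReal.ofReal_le_ofReal ?_
  have e0 := abs_self_le_fieldSum F (q r)
  have e1 := abs_fderiv_space_le (F := F) (p := q r) hu
  have e2 := abs_fderiv_fderiv_space_le (hC r) hu
  -- 13 = 1 + 3 + 9, for zero, one and two derivatives along the ray.
  have : 5 * (r ^ 2 * (13 * fieldSum F (q r))) = 65 * (r ^ 2 * fieldSum F (q r)) := by ring
  rw [← this]
  gcongr
  linarith

end Curves

/-! ### The weighted integral and the retarded potential in spherical coordinates. -/

theorem mk_mem_openSlab {t s : ℝ} (hs : s ∈ Ioo 0 t) (y : 𝔼) : (s, y) ∈ openSlab t :=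
  mem_openSlab.2 hs

/-- The space-time integral on the right-hand side of the estimate. -/
noncomputable def weightedIntegral (t : ℝ) (F : Spacetime → ℝ) : ℝ≥0∞ :=
  ∫⁻ s, ∫⁻ y : 𝔼, slabExt t (fieldSum F) (s, y) * ENNReal.ofReal ‖y‖⁻¹

theorem weightedIntegral_eq (t : ℝ) (F : Spacetime → ℝ) :
    weightedIntegral t F = ∫⁻ s in Ioo 0 t, ∫⁻ y : 𝔼,
      ENNReal.ofReal (fieldSum F (s, y) / ‖y‖) := by
  rw [weightedIntegral, ← lintegral_indicator measurableSet_Ioo]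
  refine lintegral_congr fun s => ?_
  by_cases hs : s ∈ Ioo 0 t
  · rw [indicator_of_mem hs]
    refine lintegral_congr fun y => ?_
    rw [slabExt_of_mem (mk_mem_openSlab hs _), abs_of_nonneg (fieldSum_nonneg _ _),
      ← ENNReal.ofReal_mul (fieldSum_nonneg _ _), div_eq_mul_inv]
  · rw [indicator_of_notMem hs]
    have : ∀ y : 𝔼, slabExt t (fieldSum F) (s, y) = 0 := fun y =>
      slabExt_of_notMem fun h => hs (mem_openSlab.1 h)
    simp [this]

section Spherical

variable {t : ℝ} {F : Spacetime → ℝ} {b : OrthonormalBasis (Fin 3) ℝ 𝔼}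

theorem ofReal_mul_fieldSum {s : ℝ} (hs : s ∈ Ioo 0 t) (y : 𝔼) {k σ : ℝ} (hk : 0 ≤ k)
    (hσ : 0 ≤ σ) : ENNReal.ofReal (k * (fieldSum F (s, y) * σ)) =
      ENNReal.ofReal k * (ENNReal.ofReal σ * slabExt t (fieldSum F) (s, y)) := by
  rw [slabExt_of_mem (mk_mem_openSlab hs _), abs_of_nonneg (fieldSum_nonneg _ _),
    ← ENNReal.ofReal_mul hσ, ← ENNReal.ofReal_mul hk, mul_comm σ]

/-- The weighted integral over a time slice in spherical coordinates. -/
theorem slice_spherical (hm : Measurable (slabExt t (fieldSum F))) (s : ℝ) :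
    ∫⁻ y : 𝔼, slabExt t (fieldSum F) (s, y) * ENNReal.ofReal ‖y‖⁻¹ =
      ∫⁻ r in Ioi (0 : ℝ), ∫⁻ φ in Ioo (-Real.pi) Real.pi, ENNReal.ofReal r *
        ∫⁻ θ in Ioo 0 Real.pi,
          ENNReal.ofReal (Real.sin θ) * slabExt t (fieldSum F) (s, r • sph b θ φ) := by
  rw [lintegral_spherical b (f := fun y => slabExt t (fieldSum F) (s, y) * ENNReal.ofReal ‖y‖⁻¹)
    ((hm.comp (by fun_prop)).mul (by fun_prop))]
  refine setLIntegral_congr_fun measurableSet_Ioi fun r (hr : 0 < r) => ?_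
  refine lintegral_congr fun φ => ?_
  rw [← lintegral_const_mul' _ _ ENNReal.ofReal_ne_top]
  refine setLIntegral_congr_fun measurableSet_Ioo fun θ hθ => ?_
  have hsin : 0 ≤ Real.sin θ := Real.sin_nonneg_of_nonneg_of_le_pi hθ.1.le hθ.2.le
  have hn : ‖r • sph b θ φ‖ = r := by rw [norm_smul, norm_sph, mul_one, Real.norm_of_nonneg hr.le]
  have e : ENNReal.ofReal (r ^ 2 * Real.sin θ) * ENNReal.ofReal r⁻¹ =
      ENNReal.ofReal r * ENNReal.ofReal (Real.sin θ) := by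
    rw [← ENNReal.ofReal_mul (by positivity), ← ENNReal.ofReal_mul hr.le]
    congr 1
    field_simp
  rw [hn, mul_left_comm, e, mul_comm, mul_assoc]

theorem retarded_spherical {F : Spacetime → ℝ} (hm : Measurable (slabExt t F)) (x : 𝔼) :
    ∫⁻ y : 𝔼, slabExt t F (t - ‖y‖, x + y) * ENNReal.ofReal ‖y‖⁻¹ =
      ∫⁻ r in Ioi (0 : ℝ), ∫⁻ φ in Ioo (-Real.pi) Real.pi, ∫⁻ θ in Ioo 0 Real.pi,
        ENNReal.ofReal (r * Real.sin θ) * slabExt t F (t - r, x + r • sph b θ φ) := by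
  rw [lintegral_spherical b
    (f := fun y => slabExt t F (t - ‖y‖, x + y) * ENNReal.ofReal ‖y‖⁻¹)
    ((hm.comp (by fun_prop)).mul (by fun_prop))]
  refine setLIntegral_congr_fun measurableSet_Ioi fun r (hr : 0 < r) => ?_
  refine lintegral_congr fun φ => setLIntegral_congr_fun measurableSet_Ioo fun θ hθ => ?_
  have hsin : 0 ≤ Real.sin θ := Real.sin_nonneg_of_nonneg_of_le_pi hθ.1.le hθ.2.le
  have hn : ‖r • sph b θ φ‖ = r := by rw [norm_smul, norm_sph, mul_one, Real.norm_of_nonneg hr.le]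
  have e : ENNReal.ofReal (r ^ 2 * Real.sin θ) * ENNReal.ofReal r⁻¹ =
      ENNReal.ofReal (r * Real.sin θ) := by
    rw [← ENNReal.ofReal_mul (by positivity)]
    congr 1
    field_simp
  rw [hn, mul_left_comm, e, mul_comm]

theorem lintegral_sub_eq (g : ℝ → ℝ≥0∞) : ∫⁻ r, g (t - r) = ∫⁻ s, g s :=
  lintegral_sub_left_eq_self g t

theorem exists_frame (x : 𝔼) : ∃ b : OrthonormalBasis (Fin 3) ℝ 𝔼, x = ‖x‖ • b 0 := by
  by_cases hx : x = 0
  · exact ⟨EuclideanSpace.basisFun (Fin 3) ℝ, by simp [hx]⟩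
  · have ho : Orthonormal ℝ (({0} : Set (Fin 3)).domRestrict fun _ => ‖x‖⁻¹ • x) := by
      constructor
      · intro i
        change ‖‖x‖⁻¹ • x‖ = 1
        rw [norm_smul, norm_inv, norm_norm, inv_mul_cancel₀ (norm_ne_zero_iff.2 hx)]
      · intro i j hij
        exact absurd (Subsingleton.elim i j) hij
    obtain ⟨b, hb⟩ := ho.exists_orthonormalBasis_extension_of_card_eq (by simp)
    refine ⟨b, ?_⟩
    rw [hb 0 rfl, smul_smul, mul_inv_cancel₀ (norm_ne_zero_iff.2 hx), one_smul]

theorem exists_polar_angle (a : ℝ) {c : ℝ} (hc : 0 < c) : ∃ ψ ∈ Ioo 0 Real.pi,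
    a = Real.sqrt (a ^ 2 + c ^ 2) * Real.cos ψ ∧ c = Real.sqrt (a ^ 2 + c ^ 2) * Real.sin ψ := by
  set ρ := Real.sqrt (a ^ 2 + c ^ 2) with hρ
  have hpos : 0 < ρ := Real.sqrt_pos.2 (by positivity)
  have hsq : ρ ^ 2 = a ^ 2 + c ^ 2 := Real.sq_sqrt (by positivity)
  have h1 : |a| < ρ := by
    rw [← sq_lt_sq₀ (abs_nonneg a) hpos.le, sq_abs]
    nlinarith [sq_pos_of_pos hc]
  rw [abs_lt] at h1
  have h2 : -1 < a / ρ := by rw [lt_div_iff₀ hpos]; linarith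
  have h3 : a / ρ < 1 := by rw [div_lt_iff₀ hpos]; linarith
  refine ⟨Real.arccos (a / ρ), ⟨Real.arccos_pos.2 h3, ?_⟩, ?_, ?_⟩
  · refine lt_of_le_of_ne (Real.arccos_le_pi _) fun h => ?_
    rw [Real.arccos_eq_pi] at h
    linarith
  · rw [Real.cos_arccos h2.le h3.le]
    field_simp
  · rw [Real.sin_arccos]
    have : 1 - (a / ρ) ^ 2 = (c / ρ) ^ 2 := by
      field_simp
      linarith
    rw [this, Real.sqrt_sq (by positivity)]
    field_simp

end Spherical

/-! ### Decay in |x|. -/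

section Far

variable {t : ℝ} {F : Spacetime → ℝ} {b : OrthonormalBasis (Fin 3) ℝ 𝔼}

/-- Integration over a shifted meridian, in terms of the distance to the origin. -/
theorem lintegral_shifted_meridian (hF : ContDiffOn ℝ 2 F (openSlab t)) {a r : ℝ} (ha : 0 < a)
    (hr : 0 < r) (s φ : ℝ) :
    ENNReal.ofReal a * ∫⁻ θ in Ioo 0 Real.pi,
      ENNReal.ofReal (r * Real.sin θ) * slabExt t F (s, a • b 0 + r • sph b θ φ) ≤
    ∫⁻ ρ in Ioi (0 : ℝ), ENNReal.ofReal ρ * (316 * ∫⁻ ψ in Ioo 0 Real.pi,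
      ENNReal.ofReal (Real.sin ψ) * slabExt t (fieldSum F) (s, ρ • sph b ψ φ)) := by
  by_cases hs : s ∈ Ioo 0 t
  swap
  · have : ∀ y : 𝔼, slabExt t F (s, y) = 0 := fun y =>
      slabExt_of_notMem fun h => hs (mem_openSlab.1 h)
    simp [this]
  set S : ℝ → ℝ≥0∞ := fun ρ => 316 * ∫⁻ ψ in Ioo 0 Real.pi,
      ENNReal.ofReal (Real.sin ψ) * slabExt t (fieldSum F) (s, ρ • sph b ψ φ) with hS
  set N : ℝ → ℝ := fun θ => (a + r * Real.cos θ) ^ 2 + (r * Real.sin θ) ^ 2 with hN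
  set ρ : ℝ → ℝ := fun θ => Real.sqrt (N θ) with hρ
  have hsin : ∀ θ ∈ Ioo 0 Real.pi, 0 < r * Real.sin θ := fun θ hθ =>
    mul_pos hr (Real.sin_pos_of_pos_of_lt_pi hθ.1 hθ.2)
  have hNpos : ∀ θ ∈ Ioo 0 Real.pi, 0 < N θ := fun θ hθ => by
    have := hsin θ hθ
    positivity
  have hρpos : ∀ θ ∈ Ioo 0 Real.pi, 0 < ρ θ := fun θ hθ => Real.sqrt_pos.2 (hNpos θ hθ)
  have hNeq : ∀ θ, N θ = a ^ 2 + r ^ 2 + 2 * a * r * Real.cos θ := fun θ => by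
    simp only [hN]
    linear_combination r ^ 2 * Real.sin_sq_add_cos_sq θ
  -- The point lies in the half-plane of azimuth φ, so it is on the meridian φ of the sphere of
  -- radius ρ θ about the origin; the meridian bound does not depend on its polar angle there.
  have hbound : ∀ θ ∈ Ioo 0 Real.pi, slabExt t F (s, a • b 0 + r • sph b θ φ) ≤ S (ρ θ) := by
    intro θ hθ
    obtain ⟨ψ, hψ, h1, h2⟩ := exists_polar_angle (a + r * Real.cos θ) (hsin θ hθ)
    have e : a • b 0 + r • sph b θ φ = ρ θ • sph b ψ φ := by
      have h1' : a + r * Real.cos θ = ρ θ * Real.cos ψ := h1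
      have h2' : r * Real.sin θ = ρ θ * Real.sin ψ := h2
      rw [sph_eq, sph_eq, smul_add (ρ θ), smul_smul, smul_smul, ← h1', ← h2']
      module
    rw [e, slabExt_of_mem (mk_mem_openSlab hs _)]
    refine (abs_le_lintegral_meridian hF hs (ρ θ) φ hψ).trans (le_of_eq ?_)
    have : (316 : ℝ≥0∞) = ENNReal.ofReal 316 := by norm_num
    simp only [hS]
    rw [this, ← lintegral_const_mul' _ _ ENNReal.ofReal_ne_top]
    refine setLIntegral_congr_fun measurableSet_Ioo fun ψ hψ => ?_
    exact ofReal_mul_fieldSum hs _ (by norm_num)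
      (Real.sin_nonneg_of_nonneg_of_le_pi hψ.1.le hψ.2.le)
  -- That is, ρ dρ = -a r sin θ dθ, which absorbs the factor a.
  have hder : ∀ θ ∈ Ioo 0 Real.pi,
      HasDerivWithinAt ρ (-(a * (r * Real.sin θ) / ρ θ)) (Ioo 0 Real.pi) θ := by
    intro θ hθ
    have h1 : HasDerivAt N (2 * a * r * -Real.sin θ) θ := by
      rw [funext hNeq]
      exact ((Real.hasDerivAt_cos θ).const_mul _).const_add _
    refine ((h1.sqrt (hNpos θ hθ).ne').congr_deriv ?_).hasDerivWithinAt
    have := (hρpos θ hθ).ne'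
    change 2 * a * r * -Real.sin θ / (2 * ρ θ) = _
    field_simp
  have hanti : AntitoneOn ρ (Ioo 0 Real.pi) := by
    intro θ hθ θ' hθ' h
    refine Real.sqrt_le_sqrt ?_
    rw [hNeq, hNeq]
    have := Real.strictAntiOn_cos.antitoneOn (Ioo_subset_Icc_self hθ) (Ioo_subset_Icc_self hθ') h
    gcongr
  have hcov := lintegral_image_eq_lintegral_deriv_mul_of_antitoneOn measurableSet_Ioo hder hanti
    (fun ρ => ENNReal.ofReal ρ * S ρ)
  have himg : ρ '' Ioo 0 Real.pi ⊆ Ioi 0 := by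
    rintro _ ⟨θ, hθ, rfl⟩
    exact hρpos θ hθ
  refine le_trans ?_ (hcov.symm.le.trans (lintegral_mono_set himg))
  rw [← lintegral_const_mul' _ _ ENNReal.ofReal_ne_top]
  refine setLIntegral_mono' measurableSet_Ioo fun θ hθ => ?_
  have h1 := hρpos θ hθ
  have h2 := hsin θ hθ
  rw [← mul_assoc, ← mul_assoc, ← ENNReal.ofReal_mul ha.le, neg_neg,
    ← ENNReal.ofReal_mul (by positivity), div_mul_cancel₀ _ h1.ne']
  gcongr
  exact hbound θ hθ

/-- Away from the origin the retarded potential decays like `|x|⁻¹`. -/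
theorem norm_mul_retarded_le (hF : ContDiffOn ℝ 2 F (openSlab t)) (x : 𝔼) :
    ENNReal.ofReal ‖x‖ * ∫⁻ y : 𝔼, slabExt t F (t - ‖y‖, x + y) * ENNReal.ofReal ‖y‖⁻¹ ≤
      316 * weightedIntegral t F := by
  by_cases hx : x = 0
  · simp [hx]
  obtain ⟨b, hb⟩ := exists_frame x
  have hm := measurable_slabExt_fieldSum hF.continuousOn
  rw [retarded_spherical (b := b) (measurable_slabExt hF.continuousOn) x,
    ← lintegral_const_mul' _ _ ENNReal.ofReal_ne_top]
  -- Each radius r sees only the time slice s = t - r; integrating over r afterwards becomes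
  -- integrating over s.
  have hslice : ∀ r ∈ Ioi (0 : ℝ), ENNReal.ofReal ‖x‖ * ∫⁻ φ in Ioo (-Real.pi) Real.pi,
      ∫⁻ θ in Ioo 0 Real.pi,
        ENNReal.ofReal (r * Real.sin θ) * slabExt t F (t - r, x + r • sph b θ φ) ≤
      316 * ∫⁻ y : 𝔼, slabExt t (fieldSum F) (t - r, y) * ENNReal.ofReal ‖y‖⁻¹ := by
    intro r hr
    rw [← lintegral_const_mul' _ _ ENNReal.ofReal_ne_top]
    calc _ ≤ ∫⁻ φ in Ioo (-Real.pi) Real.pi, ∫⁻ ρ in Ioi (0 : ℝ), ENNReal.ofReal ρ *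
          (316 * ∫⁻ ψ in Ioo 0 Real.pi, ENNReal.ofReal (Real.sin ψ) *
            slabExt t (fieldSum F) (t - r, ρ • sph b ψ φ)) := by
          refine lintegral_mono fun φ => ?_
          have := lintegral_shifted_meridian (b := b) hF (norm_pos_iff.2 hx) hr (t - r) φ
          rwa [← hb] at this
      _ = ∫⁻ ρ in Ioi (0 : ℝ), ∫⁻ φ in Ioo (-Real.pi) Real.pi, ENNReal.ofReal ρ *
          (316 * ∫⁻ ψ in Ioo 0 Real.pi, ENNReal.ofReal (Real.sin ψ) *
            slabExt t (fieldSum F) (t - r, ρ • sph b ψ φ)) := by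
          refine lintegral_lintegral_swap (Measurable.aemeasurable ?_)
          refine Measurable.mul (by fun_prop) (Measurable.const_mul ?_ _)
          refine Measurable.lintegral_prod_right' (f := fun z : (ℝ × ℝ) × ℝ =>
            ENNReal.ofReal (Real.sin z.2) *
              slabExt t (fieldSum F) (t - r, z.1.2 • sph b z.2 z.1.1)) ?_
          have : Continuous fun z : (ℝ × ℝ) × ℝ =>
            ((t - r, z.1.2 • sph b z.2 z.1.1) : Spacetime) := by fun_prop
          exact Measurable.mul (by fun_prop) (hm.comp this.measurable)
      _ = 316 * ∫⁻ y : 𝔼, slabExt t (fieldSum F) (t - r, y) * ENNReal.ofReal ‖y‖⁻¹ := by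
          rw [slice_spherical (b := b) hm, ← lintegral_const_mul' _ _ (by norm_num)]
          refine lintegral_congr fun ρ => ?_
          rw [← lintegral_const_mul' _ _ (by norm_num)]
          refine lintegral_congr fun φ => ?_
          rw [mul_left_comm]
  refine (setLIntegral_mono' measurableSet_Ioi hslice).trans ?_
  rw [lintegral_const_mul' _ _ (by norm_num)]
  gcongr
  refine (setLIntegral_le_lintegral _ _).trans (le_of_eq ?_)
  exact lintegral_sub_eq
    (fun s => ∫⁻ y : 𝔼, slabExt t (fieldSum F) (s, y) * ENNReal.ofReal ‖y‖⁻¹)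

end Far

/-! ### Decay in t well inside the light cone, by scaling. -/

section Near

variable {t : ℝ} {F : Spacetime → ℝ}

theorem smul_mem_openSlab {p : Spacetime} (hp : p ∈ openSlab t) {l : ℝ} (hl : l ∈ Ioo (0 : ℝ) 1) :
    l • p ∈ openSlab t := by
  rw [mem_openSlab] at hp ⊢
  simp only [Prod.smul_fst, smul_eq_mul]
  exact ⟨mul_pos hl.1 hp.1, by nlinarith [hl.1, hl.2, hp.1, hp.2]⟩

/-- The source recovered from the scaled source by integration along the scaling flow. -/
theorem slabExt_le_lintegral_scaling (hF : ContDiffOn ℝ 2 F (openSlab t)) {H : Spacetime → ℝ}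
    (hH : ContinuousOn H (closedSlab t)) (hFH : EqOn F H (openSlab t)) (p : Spacetime) :
    slabExt t F p ≤ ∫⁻ l in Ioo (0 : ℝ) 1,
      ENNReal.ofReal (l ^ 2) * slabExt t (scaledSource F) (l • p) := by
  by_cases hp : p ∈ openSlab t
  swap
  · rw [slabExt_of_notMem hp]; exact zero_le
  have hmem : ∀ l ∈ Icc (0 : ℝ) 1, l • p ∈ closedSlab t := by
    intro l hl
    have := mem_openSlab.1 hp
    rw [mem_closedSlab]
    simp only [Prod.smul_fst, smul_eq_mul]
    exact ⟨mul_nonneg hl.1 this.1.le, by nlinarith [hl.1, hl.2, this.1, this.2]⟩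
  -- The factor l³ removes the boundary term at l = 0. There the ray meets the face of time zero, so
  -- the continuous extension H replaces F.
  have hcont : ContinuousOn (fun l : ℝ => l ^ 3 * H (l • p)) (Icc 0 1) :=
    ContinuousOn.mul (by fun_prop) (hH.comp (by fun_prop) hmem)
  have hder : ∀ l ∈ Ioo (0 : ℝ) 1, HasDerivAt (fun l : ℝ => l ^ 3 * H (l • p))
      (l ^ 2 * scaledSource F (l • p)) l := by
    intro l hl
    have hl' := smul_mem_openSlab hp hl
    have hd : HasFDerivAt H (fderiv ℝ F (l • p)) (l • p) :=
      ((contDiffAt_of_slab hF hl').differentiableAt (by norm_num)).hasFDerivAt.congr_of_eventuallyEq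
        (Filter.eventually_of_mem ((isOpen_openSlab t).mem_nhds hl') fun q hq => (hFH hq).symm)
    have hline : HasDerivAt (fun l : ℝ => l • p) p l := by
      simpa using (hasDerivAt_id l).smul_const p
    refine ((hasDerivAt_pow 3 l).mul (hd.comp_hasDerivAt l hline)).congr_deriv ?_
    rw [scaledSource, scaling_apply, map_smul, smul_eq_mul, Function.comp_apply, ← hFH hl']
    norm_num
    ring
  have hcont' : ContinuousOn (fun l : ℝ => l ^ 2 * scaledSource F (l • p)) (Ioo 0 1) :=
    ContinuousOn.mul (by fun_prop) ((continuousOn_scaledSource hF).comp (by fun_prop)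
      fun l hl => smul_mem_openSlab hp hl)
  have := ofReal_abs_sub_le_lintegral zero_le_one hcont hder hcont'
  rw [slabExt_of_mem hp, hFH hp]
  simp only [one_pow, one_smul, one_mul, ne_eq, OfNat.ofNat_ne_zero, not_false_eq_true, zero_pow,
    zero_mul, sub_zero] at this
  refine this.trans (le_of_eq ?_)
  refine setLIntegral_congr_fun measurableSet_Ioo fun l hl => ?_
  rw [slabExt_of_mem (smul_mem_openSlab hp hl), abs_mul, abs_of_nonneg (sq_nonneg l),
    ENNReal.ofReal_mul (sq_nonneg l)]

theorem lintegral_comp_smul_add {K : 𝔼 → ℝ≥0∞} (hK : Measurable K) (x : 𝔼) {l : ℝ} (hl : 0 < l) :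
    ENNReal.ofReal (l ^ 3) * ∫⁻ y, K (l • (x + y)) = ∫⁻ z, K z := by
  rw [lintegral_add_left_eq_self (fun y => K (l • y)) x,
    ← lintegral_map hK (measurable_const_smul l), Measure.map_addHaar_smul volume hl.ne',
    lintegral_smul_measure, smul_eq_mul, ← mul_assoc, ← ENNReal.ofReal_mul (by positivity)]
  simp [abs_of_pos (pow_pos hl 3), (pow_pos hl 3).ne']

/-- With z = l(x+y), dy = l⁻³ dz and 1/|y| = l/|z-lx|, so the weight l² cancels exactly. This is why
F is recovered from the primitive l³F(lp). -/
theorem lintegral_scaled_retarded {G : Spacetime → ℝ≥0∞} (hG : Measurable G) (x : 𝔼) {l : ℝ}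
    (hl : 0 < l) :
    ∫⁻ y : 𝔼, ENNReal.ofReal (l ^ 2) * G (l • (t - ‖y‖, x + y)) * ENNReal.ofReal ‖y‖⁻¹ =
      ∫⁻ z : 𝔼, G (l * t - ‖z - l • x‖, z) * ENNReal.ofReal ‖z - l • x‖⁻¹ := by
  have hK : Measurable fun z : 𝔼 =>
      G (l * t - ‖z - l • x‖, z) * ENNReal.ofReal ‖z - l • x‖⁻¹ :=
    (hG.comp (by fun_prop)).mul (by fun_prop)
  rw [← lintegral_comp_smul_add hK x hl, ← lintegral_const_mul' _ _ ENNReal.ofReal_ne_top]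
  refine lintegral_congr fun y => ?_
  have e1 : l • (x + y) - l • x = l • y := by module
  have e2 : ‖l • y‖ = l * ‖y‖ := by rw [norm_smul, Real.norm_of_nonneg hl.le]
  have e3 : l • ((t - ‖y‖, x + y) : Spacetime) = (l * t - l * ‖y‖, l • (x + y)) := by
    simp [mul_sub]
  have e4 : ENNReal.ofReal (l ^ 2) * ENNReal.ofReal ‖y‖⁻¹ =
      ENNReal.ofReal (l ^ 3) * ENNReal.ofReal (l * ‖y‖)⁻¹ := by
    rw [← ENNReal.ofReal_mul (by positivity), ← ENNReal.ofReal_mul (by positivity)]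
    congr 1
    rw [mul_inv]
    field_simp
  rw [e1, e2, e3, mul_right_comm, e4, mul_assoc, mul_comm (ENNReal.ofReal _) (G _)]

/-- For a fixed position, integration in the scaling parameter is integration in time. -/
theorem lintegral_scaling_le_lintegral_time (G : Spacetime → ℝ≥0∞) {x z : 𝔼} (ht : 0 < t)
    (hx : ‖x‖ ≤ t / 2) (hz : ∀ l : ℝ, z - l • x ≠ 0) :
    ENNReal.ofReal t * ∫⁻ l in Ioo (0 : ℝ) 1, G (l * t - ‖z - l • x‖, z) ≤
      2 * ∫⁻ s, G (s, z) := by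
  set σ : ℝ → ℝ := fun l => l * t - ‖z - l • x‖ with hσ
  have hlip : LipschitzWith ‖x‖₊ fun l : ℝ => ‖z - l • x‖ := by
    refine LipschitzWith.of_dist_le_mul fun l l' => ?_
    rw [Real.dist_eq, Real.dist_eq]
    refine (abs_norm_sub_norm_le _ _).trans (le_of_eq ?_)
    have : z - l • x - (z - l' • x) = (l' - l) • x := by module
    rw [this, norm_smul, Real.norm_eq_abs, abs_sub_comm, mul_comm, coe_nnnorm]
  have hd : ∀ l, HasDerivAt σ (t - deriv (fun l : ℝ => ‖z - l • x‖) l) l := fun l => by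
    have h1 : DifferentiableAt ℝ (fun l : ℝ => ‖z - l • x‖) l :=
      DifferentiableAt.norm ℝ (by fun_prop) (hz l)
    exact (((hasDerivAt_id l).mul_const t).sub h1.hasDerivAt).congr_deriv (by simp)
  -- The norm is Lipschitz in l with constant ‖x‖ ≤ t/2, so the time is increasing in l with slope
  -- at least t/2.
  have hdl : ∀ l, t / 2 ≤ t - deriv (fun l : ℝ => ‖z - l • x‖) l := fun l => by
    have h1 := norm_deriv_le_of_lipschitz (x₀ := l) hlip
    have h2 := (le_abs_self _).trans h1
    rw [coe_nnnorm] at h2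
    linarith
  have hmono : Monotone σ := monotone_of_deriv_nonneg (fun l => (hd l).differentiableAt)
    fun l => by rw [(hd l).deriv]; linarith [hdl l]
  have hcov := lintegral_image_eq_lintegral_deriv_mul_of_monotoneOn
    (measurableSet_Ioo (a := (0 : ℝ)) (b := 1))
    (fun l _ => (hd l).hasDerivWithinAt) (hmono.monotoneOn _) (fun s => G (s, z))
  rw [← lintegral_const_mul' _ _ ENNReal.ofReal_ne_top]
  calc _ ≤ ∫⁻ l in Ioo (0 : ℝ) 1, 2 *
        (ENNReal.ofReal (t - deriv (fun l : ℝ => ‖z - l • x‖) l) * G (σ l, z)) := by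
        refine lintegral_mono fun l => ?_
        rw [← mul_assoc]
        refine mul_le_mul_left ?_ _
        have h2 : t ≤ 2 * (t - deriv (fun l : ℝ => ‖z - l • x‖) l) := by linarith [hdl l]
        refine (ENNReal.ofReal_le_ofReal h2).trans ?_
        rw [ENNReal.ofReal_mul zero_le_two, ENNReal.ofReal_ofNat]
    _ = 2 * ∫⁻ s in σ '' Ioo 0 1, G (s, z) := by
        rw [hcov, lintegral_const_mul' _ _ (by norm_num)]
    _ ≤ _ := mul_le_mul' le_rfl (setLIntegral_le_lintegral _ _)

/-- The distance to the axis spanned by the first vector of the frame. -/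
noncomputable def axisDist (b : OrthonormalBasis (Fin 3) ℝ 𝔼) (z : 𝔼) : ℝ :=
  Real.sqrt (inner ℝ (b 1) z ^ 2 + inner ℝ (b 2) z ^ 2)

variable {b : OrthonormalBasis (Fin 3) ℝ 𝔼}

/-- Pythagoras, dropping the component along `b 0`. The bound is uniform in c, so the singular
factor can be taken out of the integral over the scaling parameter. -/
theorem axisDist_le (z : 𝔼) (c : ℝ) : axisDist b z ≤ ‖z - c • b 0‖ := by
  refine Real.sqrt_le_iff.2 ⟨norm_nonneg _, ?_⟩
  rw [← b.sum_sq_norm_inner_right, Fin.sum_univ_three]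
  have h1 : inner ℝ (b 1) (z - c • b 0) = inner ℝ (b 1) z := by
    simp [inner_sub_right, inner_smul_right]
  have h2 : inner ℝ (b 2) (z - c • b 0) = inner ℝ (b 2) z := by
    simp [inner_sub_right, inner_smul_right]
  rw [h1, h2, Real.norm_eq_abs, Real.norm_eq_abs, Real.norm_eq_abs, sq_abs, sq_abs, sq_abs]
  nlinarith [sq_nonneg (inner ℝ (b 0) (z - c • b 0))]

theorem axisDist_sph {r θ φ : ℝ} (hr : 0 ≤ r) (hθ : θ ∈ Ioo 0 Real.pi) :
    axisDist b (r • sph b θ φ) = r * Real.sin θ := by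
  have hs := Real.sin_nonneg_of_nonneg_of_le_pi hθ.1.le hθ.2.le
  have h : inner ℝ (b 1) (r • sph b θ φ) ^ 2 + inner ℝ (b 2) (r • sph b θ φ) ^ 2 =
      (r * Real.sin θ) ^ 2 := by
    simp [sph, inner_smul_right, inner_add_right]
    linear_combination r ^ 2 * Real.sin θ ^ 2 * Real.sin_sq_add_cos_sq φ
  rw [axisDist, h, Real.sqrt_sq (mul_nonneg hr hs)]

/-- The axis lies in the plane orthogonal to `b 1`, a proper subspace and hence null. Off the axis z
- lx never vanishes, and its norm is differentiable in l. -/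
theorem ae_axisDist_pos : ∀ᵐ z : 𝔼, 0 < axisDist b z := by
  have h : volume ((LinearMap.ker (innerSL ℝ (b 1)).toLinearMap : Submodule ℝ 𝔼) : Set 𝔼) = 0 := by
    refine Measure.addHaar_submodule _ _ fun h => ?_
    have : b 1 ∈ LinearMap.ker (innerSL ℝ (b 1)).toLinearMap := by rw [h]; trivial
    simp at this
  filter_upwards [measure_eq_zero_iff_ae_notMem.1 h] with z hz
  have hz' : inner ℝ (b 1) z ≠ 0 := by simpa using hz
  exact Real.sqrt_pos.2 (by positivity)

theorem measurable_axisDist : Measurable (axisDist b) := by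
  unfold axisDist; fun_prop

/-- Dividing r² sin θ by the axis distance r sin θ leaves r, with no sine. Hardy's inequality on
each meridian restores it, and r sin θ is the density of dy/|y|. -/
theorem slice_axis_le (hF : ContDiffOn ℝ 2 F (openSlab t)) (s : ℝ) :
    ∫⁻ z : 𝔼, slabExt t (scaledSource F) (s, z) * ENNReal.ofReal (axisDist b z)⁻¹ ≤
      56 * ∫⁻ y : 𝔼, slabExt t (fieldSum F) (s, y) * ENNReal.ofReal ‖y‖⁻¹ := by
  by_cases hs : s ∈ Ioo 0 t
  swap
  · have : ∀ y : 𝔼, slabExt t (scaledSource F) (s, y) = 0 := fun y =>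
      slabExt_of_notMem fun h => hs (mem_openSlab.1 h)
    simp [this]
  rw [slice_spherical (b := b) (measurable_slabExt_fieldSum hF.continuousOn),
    lintegral_spherical b
      (f := fun z => slabExt t (scaledSource F) (s, z) * ENNReal.ofReal (axisDist b z)⁻¹)
      (((measurable_slabExt (continuousOn_scaledSource hF)).comp (by fun_prop)).mul
        measurable_axisDist.inv.ennreal_ofReal),
    ← lintegral_const_mul' _ _ (by norm_num)]
  refine setLIntegral_mono' measurableSet_Ioi fun r (hr : 0 < r) => ?_
  rw [← lintegral_const_mul' _ _ (by norm_num)]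
  refine lintegral_mono fun φ => ?_
  calc _ = ∫⁻ θ in Ioo 0 Real.pi, ENNReal.ofReal r *
        ENNReal.ofReal |scaledSource F (s, r • sph b θ φ)| := by
        refine setLIntegral_congr_fun measurableSet_Ioo fun θ hθ => ?_
        have hsin : 0 < Real.sin θ := Real.sin_pos_of_pos_of_lt_pi hθ.1 hθ.2
        have e : ENNReal.ofReal (r ^ 2 * Real.sin θ) * ENNReal.ofReal (r * Real.sin θ)⁻¹ =
            ENNReal.ofReal r := by
          rw [← ENNReal.ofReal_mul (by positivity)]
          congr 1
          field_simp
        rw [axisDist_sph hr.le hθ, slabExt_of_mem (mk_mem_openSlab hs _), mul_left_comm, e,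
          mul_comm]
    _ = ENNReal.ofReal r * ∫⁻ θ in Ioo 0 Real.pi,
        ENNReal.ofReal |scaledSource F (s, r • sph b θ φ)| :=
        lintegral_const_mul' _ _ ENNReal.ofReal_ne_top
    _ ≤ ENNReal.ofReal r * ∫⁻ ψ in Ioo 0 Real.pi,
        ENNReal.ofReal (56 * (fieldSum F (s, r • sph b ψ φ) * Real.sin ψ)) :=
        mul_le_mul' le_rfl (lintegral_scaledSource_meridian hF hs r φ)
    _ = _ := by
        rw [mul_left_comm, ← lintegral_const_mul' 56 _ (by norm_num)]
        congr 1
        refine setLIntegral_congr_fun measurableSet_Ioo fun ψ hψ => ?_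
        rw [ofReal_mul_fieldSum hs _ (by norm_num)
          (Real.sin_nonneg_of_nonneg_of_le_pi hψ.1.le hψ.2.le)]
        norm_num

/-- Well inside the light cone the retarded potential decays like `t⁻¹`. -/
theorem time_mul_retarded_le (ht : 0 < t) (hF : ContDiffOn ℝ 2 F (openSlab t))
    {H : Spacetime → ℝ} (hH : ContinuousOn H (closedSlab t)) (hFH : EqOn F H (openSlab t))
    {x : 𝔼} (hx : ‖x‖ ≤ t / 2) :
    ENNReal.ofReal t * ∫⁻ y : 𝔼, slabExt t F (t - ‖y‖, x + y) * ENNReal.ofReal ‖y‖⁻¹ ≤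
      112 * weightedIntegral t F := by
  obtain ⟨b, hb⟩ := exists_frame x
  set G := slabExt t (scaledSource F) with hGdef
  have hG : Measurable G := measurable_slabExt (continuousOn_scaledSource hF)
  -- The scaling formula is inserted in the potential; the change of variables is made for fixed l,
  -- then z is moved outside to integrate in l.
  have hmain : ∫⁻ y : 𝔼, slabExt t F (t - ‖y‖, x + y) * ENNReal.ofReal ‖y‖⁻¹ ≤
      ∫⁻ z : 𝔼, ∫⁻ l in Ioo (0 : ℝ) 1,
        G (l * t - ‖z - l • x‖, z) * ENNReal.ofReal ‖z - l • x‖⁻¹ := by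
    calc _ ≤ ∫⁻ y : 𝔼, ∫⁻ l in Ioo (0 : ℝ) 1,
          ENNReal.ofReal (l ^ 2) * G (l • (t - ‖y‖, x + y)) * ENNReal.ofReal ‖y‖⁻¹ := by
          refine lintegral_mono fun y => ?_
          rw [lintegral_mul_const' _ _ ENNReal.ofReal_ne_top]
          gcongr
          exact slabExt_le_lintegral_scaling hF hH hFH _
      _ = ∫⁻ l in Ioo (0 : ℝ) 1, ∫⁻ y : 𝔼,
          ENNReal.ofReal (l ^ 2) * G (l • (t - ‖y‖, x + y)) * ENNReal.ofReal ‖y‖⁻¹ := by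
          refine lintegral_lintegral_swap (Measurable.aemeasurable ?_)
          have : Continuous fun z : 𝔼 × ℝ => z.2 • ((t - ‖z.1‖, x + z.1) : Spacetime) := by
            fun_prop
          exact (Measurable.mul (by fun_prop) (hG.comp this.measurable)).mul (by fun_prop)
      _ = ∫⁻ l in Ioo (0 : ℝ) 1, ∫⁻ z : 𝔼,
          G (l * t - ‖z - l • x‖, z) * ENNReal.ofReal ‖z - l • x‖⁻¹ :=
          setLIntegral_congr_fun measurableSet_Ioo fun l hl =>
            lintegral_scaled_retarded hG x hl.1
      _ = _ := by
          refine lintegral_lintegral_swap (Measurable.aemeasurable ?_)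
          have : Continuous fun z : ℝ × 𝔼 => ((z.1 * t - ‖z.2 - z.1 • x‖, z.2) : Spacetime) := by
            fun_prop
          exact (hG.comp this.measurable).mul (by fun_prop)
  calc _ ≤ ENNReal.ofReal t * ∫⁻ z : 𝔼, ∫⁻ l in Ioo (0 : ℝ) 1,
        G (l * t - ‖z - l • x‖, z) * ENNReal.ofReal ‖z - l • x‖⁻¹ := by gcongr
    _ = ∫⁻ z : 𝔼, ENNReal.ofReal t * ∫⁻ l in Ioo (0 : ℝ) 1,
        G (l * t - ‖z - l • x‖, z) * ENNReal.ofReal ‖z - l • x‖⁻¹ :=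
        (lintegral_const_mul' _ _ ENNReal.ofReal_ne_top).symm
    _ ≤ ∫⁻ z : 𝔼, 2 * ((∫⁻ s, G (s, z)) * ENNReal.ofReal (axisDist b z)⁻¹) := by
        refine lintegral_mono_ae ?_
        filter_upwards [ae_axisDist_pos (b := b)] with z hz
        have hle : ∀ l : ℝ, axisDist b z ≤ ‖z - l • x‖ := fun l => by
          rw [hb, smul_smul]; exact axisDist_le z _
        have hne : ∀ l : ℝ, z - l • x ≠ 0 := fun l => norm_pos_iff.1 (hz.trans_le (hle l))
        calc _ ≤ ENNReal.ofReal t * ∫⁻ l in Ioo (0 : ℝ) 1,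
              G (l * t - ‖z - l • x‖, z) * ENNReal.ofReal (axisDist b z)⁻¹ := by
              gcongr with l
              exact hle l
          _ = (ENNReal.ofReal t * ∫⁻ l in Ioo (0 : ℝ) 1, G (l * t - ‖z - l • x‖, z)) *
              ENNReal.ofReal (axisDist b z)⁻¹ := by
              rw [lintegral_mul_const' _ _ ENNReal.ofReal_ne_top, mul_assoc]
          _ ≤ (2 * ∫⁻ s, G (s, z)) * ENNReal.ofReal (axisDist b z)⁻¹ :=
              mul_le_mul' (lintegral_scaling_le_lintegral_time G ht hx hne) le_rfl
          _ = _ := mul_assoc _ _ _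
    _ = 2 * ∫⁻ z : 𝔼, ∫⁻ s, G (s, z) * ENNReal.ofReal (axisDist b z)⁻¹ := by
        rw [lintegral_const_mul' _ _ (by norm_num)]
        congr 1
        refine lintegral_congr fun z => ?_
        rw [lintegral_mul_const' _ _ ENNReal.ofReal_ne_top]
    _ = 2 * ∫⁻ s, ∫⁻ z : 𝔼, G (s, z) * ENNReal.ofReal (axisDist b z)⁻¹ := by
        congr 1
        refine lintegral_lintegral_swap (Measurable.aemeasurable ?_)
        exact (hG.comp (by fun_prop : Measurable fun z : 𝔼 × ℝ => (z.2, z.1))).mul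
          (measurable_axisDist.comp measurable_fst).inv.ennreal_ofReal
    _ ≤ 2 * ∫⁻ s, 56 * ∫⁻ y : 𝔼, slabExt t (fieldSum F) (s, y) * ENNReal.ofReal ‖y‖⁻¹ := by
        gcongr with s
        exact slice_axis_le hF s
    _ = _ := by
        rw [lintegral_const_mul' _ _ (by norm_num), ← mul_assoc, weightedIntegral]
        norm_num

end Near

/-! ### Small times and positions. -/

section SmallTime

variable {t : ℝ} {F : Spacetime → ℝ}

/-- The weighted integral controls the integral over a bounded ball. -/
theorem lintegral_ball_le (G : 𝔼 → ℝ≥0∞) {x : 𝔼} (hx : ‖x‖ ≤ 1) :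
    ∫⁻ y, (Metric.ball (0 : 𝔼) 2).indicator (fun y => G (x + y)) y ≤
      3 * ∫⁻ y, G y * ENNReal.ofReal ‖y‖⁻¹ := by
  rw [← lintegral_add_left_eq_self (fun y => G y * ENNReal.ofReal ‖y‖⁻¹) x,
    ← lintegral_const_mul' _ _ (by norm_num)]
  refine lintegral_mono_ae ?_
  filter_upwards [measure_eq_zero_iff_ae_notMem.1 (measure_singleton (-x))] with y hy
  by_cases hy2 : y ∈ Metric.ball (0 : 𝔼) 2
  · rw [indicator_of_mem hy2]
    have hpos : 0 < ‖x + y‖ := norm_pos_iff.2 fun h => hy (by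
      rw [mem_singleton_iff]; exact (neg_eq_of_add_eq_zero_right h).symm)
    have h3 : ‖x + y‖ ≤ 3 := by
      rw [mem_ball_zero_iff] at hy2
      linarith [norm_add_le x y]
    have h1 : (1 : ℝ≥0∞) ≤ 3 * ENNReal.ofReal ‖x + y‖⁻¹ := by
      rw [← ENNReal.ofReal_ofNat, ← ENNReal.ofReal_mul (by norm_num), ← ENNReal.ofReal_one]
      refine ENNReal.ofReal_le_ofReal ?_
      rw [← div_eq_mul_inv, le_div_iff₀ hpos]
      linarith
    calc G (x + y) = G (x + y) * 1 := (mul_one _).symm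
      _ ≤ G (x + y) * (3 * ENNReal.ofReal ‖x + y‖⁻¹) := mul_le_mul' le_rfl h1
      _ = _ := mul_left_comm _ _ _
  · rw [indicator_of_notMem hy2]
    exact zero_le

/-- For small times and positions the retarded potential is bounded. -/
theorem retarded_small_le (ht : t ≤ 1) (hF : ContDiffOn ℝ 2 F (openSlab t)) {x : 𝔼}
    (hx : ‖x‖ ≤ 1) :
    ∫⁻ y : 𝔼, slabExt t F (t - ‖y‖, x + y) * ENNReal.ofReal ‖y‖⁻¹ ≤
      195 * weightedIntegral t F := by
  set b := EuclideanSpace.basisFun (Fin 3) ℝ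
  have hm := measurable_slabExt_fieldSum hF.continuousOn
  set Q := slabExt t (fieldSum F) with hQ
  rw [retarded_spherical (b := b) (measurable_slabExt hF.continuousOn) x]
  have hslice : ∀ r ∈ Ioi (0 : ℝ), ∫⁻ φ in Ioo (-Real.pi) Real.pi, ∫⁻ θ in Ioo 0 Real.pi,
        ENNReal.ofReal (r * Real.sin θ) * slabExt t F (t - r, x + r • sph b θ φ) ≤
      195 * ∫⁻ y : 𝔼, Q (t - r, y) * ENNReal.ofReal ‖y‖⁻¹ := by
    intro r (hr : 0 < r)
    by_cases hs : t - r ∈ Ioo 0 t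
    swap
    · have : ∀ y : 𝔼, slabExt t F (t - r, y) = 0 := fun y =>
        slabExt_of_notMem fun h => hs (mem_openSlab.1 h)
      simp [this]
    have hcont : Continuous fun z : (ℝ × ℝ) × ℝ =>
        ((t - r, x + z.2 • sph b z.1.2 z.1.1) : Spacetime) := by fun_prop
    have hmz : Measurable fun z : (ℝ × ℝ) × ℝ => ENNReal.ofReal (z.2 ^ 2 * Real.sin z.1.2) *
        Q (t - r, x + z.2 • sph b z.1.2 z.1.1) :=
      Measurable.mul (by fun_prop) (hm.comp hcont.measurable)
    -- The factor r of the measure r sin θ is the weight τ in the ray inequality, applicable as r ≤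
    -- t ≤ 1. Time stays frozen at t - r while ρ runs over (0,2), and ρ² sin θ is the volume density
    -- of the ball.
    calc _ ≤ ∫⁻ φ in Ioo (-Real.pi) Real.pi, ∫⁻ θ in Ioo 0 Real.pi, ∫⁻ ρ in Ioo (0 : ℝ) 2,
          65 * (ENNReal.ofReal (ρ ^ 2 * Real.sin θ) * Q (t - r, x + ρ • sph b θ φ)) := by
          refine lintegral_mono fun φ => setLIntegral_mono' measurableSet_Ioo fun θ hθ => ?_
          have hsin := Real.sin_nonneg_of_nonneg_of_le_pi hθ.1.le hθ.2.le
          have := mul_abs_le_lintegral_ray hF hs x (norm_sph b θ φ).le hr.le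
            (by linarith [hs.1] : r ≤ 1)
          rw [slabExt_of_mem (mk_mem_openSlab hs _), mul_comm r, ENNReal.ofReal_mul hsin,
            mul_assoc, ← ENNReal.ofReal_mul hr.le]
          refine (mul_le_mul' le_rfl this).trans (le_of_eq ?_)
          rw [← lintegral_const_mul' _ _ ENNReal.ofReal_ne_top]
          refine lintegral_congr fun ρ => ?_
          rw [mul_comm (ρ ^ 2), mul_comm (ρ ^ 2), ofReal_mul_fieldSum hs _ (by norm_num)
            (sq_nonneg ρ), ENNReal.ofReal_mul hsin, ENNReal.ofReal_ofNat, mul_left_comm, mul_assoc]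
      _ = ∫⁻ φ in Ioo (-Real.pi) Real.pi, ∫⁻ ρ in Ioo (0 : ℝ) 2, ∫⁻ θ in Ioo 0 Real.pi,
          65 * (ENNReal.ofReal (ρ ^ 2 * Real.sin θ) * Q (t - r, x + ρ • sph b θ φ)) := by
          refine lintegral_congr fun φ => lintegral_lintegral_swap (Measurable.aemeasurable ?_)
          exact (hmz.comp (by fun_prop : Measurable fun z : ℝ × ℝ => ((φ, z.1), z.2))).const_mul 65
      _ = ∫⁻ ρ in Ioo (0 : ℝ) 2, ∫⁻ φ in Ioo (-Real.pi) Real.pi, ∫⁻ θ in Ioo 0 Real.pi,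
          65 * (ENNReal.ofReal (ρ ^ 2 * Real.sin θ) * Q (t - r, x + ρ • sph b θ φ)) := by
          refine lintegral_lintegral_swap (Measurable.aemeasurable ?_)
          refine Measurable.lintegral_prod_right' (f := fun z : (ℝ × ℝ) × ℝ =>
            65 * (ENNReal.ofReal (z.1.2 ^ 2 * Real.sin z.2) *
              Q (t - r, x + z.1.2 • sph b z.2 z.1.1))) ?_
          exact (hmz.comp (by fun_prop : Measurable fun z : (ℝ × ℝ) × ℝ =>
            ((z.1.1, z.2), z.1.2))).const_mul 65
      _ ≤ 65 * ∫⁻ y, (Metric.ball (0 : 𝔼) 2).indicator (fun y => Q (t - r, x + y)) y := by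
          have hmx : Measurable fun y : 𝔼 => Q (t - r, x + y) := hm.comp (by fun_prop)
          rw [lintegral_spherical b (hmx.indicator measurableSet_ball),
            ← lintegral_const_mul' _ _ (by norm_num)]
          refine (setLIntegral_mono' measurableSet_Ioo fun ρ hρ => ?_).trans
            (lintegral_mono_set Ioo_subset_Ioi_self)
          rw [← lintegral_const_mul' _ _ (by norm_num)]
          refine lintegral_mono fun φ => ?_
          rw [← lintegral_const_mul' _ _ (by norm_num)]
          refine lintegral_mono fun θ => ?_
          rw [indicator_of_mem]
          rw [mem_ball_zero_iff, norm_smul, norm_sph, mul_one, Real.norm_of_nonneg hρ.1.le]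
          exact hρ.2
      _ ≤ 65 * (3 * ∫⁻ y : 𝔼, Q (t - r, y) * ENNReal.ofReal ‖y‖⁻¹) :=
          mul_le_mul' le_rfl (lintegral_ball_le (fun y => Q (t - r, y)) hx)
      _ = _ := by rw [← mul_assoc]; norm_num
  refine (setLIntegral_mono' measurableSet_Ioi hslice).trans ?_
  rw [lintegral_const_mul' _ _ (by norm_num)]
  refine mul_le_mul' le_rfl ((setLIntegral_le_lintegral _ _).trans (le_of_eq ?_))
  exact lintegral_sub_eq
    (fun s => ∫⁻ y : 𝔼, slabExt t (fieldSum F) (s, y) * ENNReal.ofReal ‖y‖⁻¹)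

end SmallTime

/-! ### Regularity of the source, and the conclusion. -/

theorem contDiffOn_dt {U : Set Spacetime} (hU : IsOpen U) {m n : WithTop ℕ∞} (hmn : m + 1 ≤ n)
    {f : Spacetime → ℝ} (hf : ContDiffOn ℝ n f U) : ContDiffOn ℝ m (dt f) U :=
  (hf.fderiv_of_isOpen hU hmn).clm_apply contDiffOn_const

theorem contDiffOn_dx {U : Set Spacetime} (hU : IsOpen U) {m n : WithTop ℕ∞} (hmn : m + 1 ≤ n)
    {f : Spacetime → ℝ} (hf : ContDiffOn ℝ n f U) (i : Fin 3) : ContDiffOn ℝ m (dx i f) U :=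
  (hf.fderiv_of_isOpen hU hmn).clm_apply contDiffOn_const

theorem contDiffOn_box {U : Set Spacetime} (hU : IsOpen U) {f : Spacetime → ℝ}
    (hf : ContDiffOn ℝ 5 f U) : ContDiffOn ℝ 2 (box f) U :=
  (contDiffOn_dt hU (n := 3) (by norm_num) (contDiffOn_dt hU (n := 5) (by norm_num) hf)).sub
    (ContDiffOn.sum fun i _ => contDiffOn_dx hU (n := 3) (by norm_num)
      (contDiffOn_dx hU (n := 5) (by norm_num) hf i) i)

end WaveEstimate

theorem proposition2p1 :
    ∃ C : ℝ≥0, ∀ (t : ℝ) (_ht : 0 ≤ t) (w F : WaveEstimate.Spacetime → ℝ)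
      (_hw : ContDiffOn ℝ 5 w (Icc 0 t ×ˢ univ))
      (_hF : ∀ p ∈ Ioo 0 t ×ˢ (univ : Set (EuclideanSpace ℝ (Fin 3))),
        WaveEstimate.box w p = F p)
      (_h0 : ∀ x : EuclideanSpace ℝ (Fin 3), w (0, x) = 0)
      (_h1 : ∀ x : EuclideanSpace ℝ (Fin 3),
        HasDerivWithinAt (fun s : ℝ => w (s, x)) 0 (Icc 0 t) 0)
      (x : EuclideanSpace ℝ (Fin 3)),
      ENNReal.ofReal ((1 + t) * |w (t, x)|) ≤
        C * ∫⁻ s in Ioo 0 t, ∫⁻ y : EuclideanSpace ℝ (Fin 3),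
          ENNReal.ofReal (WaveEstimate.fieldSum F (s, y) / ‖y‖) := by
  -- Any constant from 632 + 632 = 1264 on would do.
  refine ⟨1500, fun t ht w F hw hF h0 h1 x => ?_⟩
  rcases ht.eq_or_lt with rfl | ht
  · simp [h0]
  obtain ⟨J⟩ := WaveEstimate.SlabJet.nonempty ht (hw.of_le (by norm_num))
  have hF2 : ContDiffOn ℝ 2 F (WaveEstimate.openSlab t) :=
    (WaveEstimate.contDiffOn_box (WaveEstimate.isOpen_openSlab t)
      (hw.mono (WaveEstimate.openSlab_subset t))).congr fun p hp => (hF p hp).symm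
  have hFJ : EqOn F J.wave (WaveEstimate.openSlab t) := fun p hp => by
    rw [← hF p hp, J.box_eq_wave hp]
  have hret := J.retarded_le ht h0 h1 hF x
  rw [← WaveEstimate.weightedIntegral_eq]
  set R := WaveEstimate.weightedIntegral t F
  have hfar : ENNReal.ofReal (‖x‖ * |w (t, x)|) ≤ 316 * R := by
    rw [ENNReal.ofReal_mul (norm_nonneg x)]
    exact (mul_le_mul' le_rfl hret).trans (WaveEstimate.norm_mul_retarded_le hF2 x)
  -- Where ‖x‖ ≥ t/2 the decay in |x| already gives decay in t, with 632 = 2 · 316.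
  have htime : ENNReal.ofReal (t * |w (t, x)|) ≤ 632 * R := by
    rcases le_total ‖x‖ (t / 2) with hx | hx
    · rw [ENNReal.ofReal_mul ht.le]
      refine (mul_le_mul' le_rfl hret).trans
        ((WaveEstimate.time_mul_retarded_le ht hF2 J.continuousOn_wave hFJ hx).trans ?_)
      gcongr
      norm_num
    · calc ENNReal.ofReal (t * |w (t, x)|) ≤ ENNReal.ofReal (2 * (‖x‖ * |w (t, x)|)) := by
            refine ENNReal.ofReal_le_ofReal ?_
            nlinarith [abs_nonneg (w (t, x))]
        _ = 2 * ENNReal.ofReal (‖x‖ * |w (t, x)|) := by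
            rw [ENNReal.ofReal_mul zero_le_two, ENNReal.ofReal_ofNat]
        _ ≤ 2 * (316 * R) := mul_le_mul' le_rfl hfar
        _ = 632 * R := by rw [← mul_assoc]; norm_num
  -- If t ≥ 1 or ‖x‖ ≥ 1 a decay estimate suffices; the remaining region t, ‖x‖ ≤ 1 needs the
  -- small-time bound.
  have hone : ENNReal.ofReal |w (t, x)| ≤ 632 * R := by
    rcases le_total 1 t with h | h
    · refine (ENNReal.ofReal_le_ofReal ?_).trans htime
      nlinarith [abs_nonneg (w (t, x))]
    · rcases le_total 1 ‖x‖ with hx | hx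
      · refine (ENNReal.ofReal_le_ofReal (?_ : _ ≤ ‖x‖ * |w (t, x)|)).trans (hfar.trans ?_)
        · nlinarith [abs_nonneg (w (t, x))]
        · gcongr
          norm_num
      · refine hret.trans ((WaveEstimate.retarded_small_le h hF2 hx).trans ?_)
        gcongr
        norm_num
  calc ENNReal.ofReal ((1 + t) * |w (t, x)|) =
        ENNReal.ofReal |w (t, x)| + ENNReal.ofReal (t * |w (t, x)|) := by
        rw [← ENNReal.ofReal_add (abs_nonneg _) (by positivity)]
        ring_nf
    _ ≤ 632 * R + 632 * R := add_le_add hone htime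
    _ = 1264 * R := by rw [← add_mul]; norm_num
    _ ≤ ((1500 : ℝ≥0) : ℝ≥0∞) * R := by
        gcongr
        norm_num
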